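/- **LSE convergence rate.** *Market.* Let $\alpha\in[0,1]$, $r_o^b\in\mathbb R$, $c\in(0,1]$, $\mu\in\mathbb R$, $\sigma>0$, $\zeta>0$ and $\eta_b>0$ be constant. The collateral price is a geometric Brownian motion $p_{t+1}=p_t\exp(\mu+\sigma z_t)$, $z_t\sim\mathcal N(0,1)$ i.i.d., $p_0>0$. Every unit of debt is backed by $\frac1{c\,p_t}$ units of collateral (loan-to-value ratio $c$), and expected liquidations are zero. At interest rate $r$ and price $p=p_t$, with expected default $\pi=\mathbb E[\max\{0,1-\tfrac{p_{t+1}}{c\,p}\}]$ of a unit of debt, the two types of borrowers have utilities $$u^{1}=r_o^b-r+\pi+\tfrac1{c\,p}\,\mathbb E\big[\mathbf 1_{p_{t+1}<p}\,(p_{t+1}-p)\big],\qquad u^{2}=-r+\pi+\mathbb E\big[\tfrac{p_{t+1}-p}{p}\big],$$ expectations being over $p_{t+1}$ given $p_t=p$. The total debt $B_t$ (with $B_0>0$) evolves by $$\frac{B_{t+1}-B_t}{B_t}=\eta_b\big(\alpha u^1+(1-\alpha)u^2\big)+\varepsilon_t,\qquad \varepsilon_t\sim\mathcal N(0,\zeta^2)\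 \text{i.i.d., independent of }(z_t).$$ With $X=p_{t+1}/p_t$, the equilibrium interest rate, at which the expected change of the debt vanishes, is $$r^*=\alpha r_o^b+\mathbb E\big[\max\{0,1-\tfrac Xc\}\big]+\tfrac{\alpha}{c}\,\mathbb E\big[\mathbf 1_{X<1}(X-1)\big]+(1-\alpha)\,\mathbb E[X-1],$$ so that $\frac{B_{t+1}-B_t}{B_t}=\eta_b(r^*-r_t)+\varepsilon_t$. *Controller.* Fix an exploration probability $\nu\in(0,1]$ and $r_{\min}<r_{\max}$. At time $0$ an arbitrary rate $r_0\in\mathbb R$ is in force (for instance the equilibrium rate of the market before its parameters changed), and the controller, once activated, collects samples $(r_s,\Delta B_s)$, $\Delta B_s=\frac{B_{s+1}-B_s}{B_s}$, in consecutive slots $s=0,1,2,\dots$ without resets. From the first $n$ samples it computes the least-squares coefficients $\hat\Theta=(P^\top P)^{-1}P^\top\Delta B$, where $P$ has the rows $[1,r_s]$, $s<n$, and the estimate $\hat r_n=-\hat\Theta(0)/\hat\Theta(1)$; while this is undefined ($P^\top P$ singular or $\hat\Theta(1)=0$), $\hat r_n$ is the current rate $r_{n-1}$. Then, independently of everything else,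 it sets $r_n=\hat r_n$ with probability $1-\nu$, and with probability $\nu$ it draws $r_n$ uniformly from $[r_{\min},r_{\max}]$. The controller that stops after $\tau$ samples outputs $r_\tau:=\hat r_\tau$ (without exploration). *Claim 1.* The rate of equilibrium convergence is $O\big(\log(1/\delta)/\sqrt\tau\big)$: there is a constant $C>0$, depending only on the market parameters above and on $\nu,r_{\min},r_{\max}$, such that for all $r_0\in\mathbb R$, $p_0>0$, $B_0>0$ and all $\delta\in(0,1)$ there is a $T(\delta)$ with $$\mathbb P\Big(|r_\tau-r^*|<C\,\frac{\log(1/\delta)}{\sqrt\tau}\Big)\ \ge\ 1-\delta\qquad\text{for every }\tau>T(\delta).$$ *Claim 2.* Suppose $\eta_b$ is known, so that the controller fits by least squares only the unknown intercept $\theta=\eta_b r^*$ of $\Delta B_s=\theta-\eta_b r_s+\varepsilon_s$ and uses $\hat r_n=\hat\theta_n/\eta_b$, $\hat\theta_n=\frac1n\sum_{s<n}(\Delta B_s+\eta_b r_s)$, in place of the estimate above (exploration and output as before). Then for all $r_0\in\mathbb R$, $p_0>0$, $B_0>0$ and every $\tau\ge1$, $r_\tau$ is integrable and $\mathbb E[r_\tau]=r^*$.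 -/

import Mathlib

open MeasureTheory ProbabilityTheory

noncomputable section

namespace LendingPool

/-- Parameters of the market during a period in which it is stable. -/
structure Market where
  /-- fraction of financing borrowers; the others are leveraged traders -/
  α : ℝ
  /-- external (risk-free) borrow rate -/
  rExt : ℝ
  /-- collateral factor: the loan-to-value ratio kept by the borrowers -/
  c : ℝ
  /-- drift of the collateral price -/
  μ : ℝ
  /-- volatility of the collateral price -/
  σ : ℝ
  /-- elasticity of the borrowers -/
  η : ℝ
  /-- standard deviation of the noise in the borrowers' behaviour -/
  ζ : NNReal
  α_nonneg : 0 ≤ α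
  α_le_one : α ≤ 1
  c_pos : 0 < c
  c_le_one : c ≤ 1
  σ_pos : 0 < σ
  ζ_pos : 0 < ζ

namespace Market

variable (m : Market)

/-- One step of the geometric Brownian price: the price after `p` under the standard normal
innovation `z`. -/
def nextPrice (p z : ℝ) : ℝ := p * Real.exp (m.μ + m.σ * z)

/-- Expectation of `f p'` over the next price `p'`, given that the current price is `p`. -/
def priceExp (p : ℝ) (f : ℝ → ℝ) : ℝ := ∫ z, f (m.nextPrice p z) ∂(gaussianReal 0 1)

/-- Collateral posted at price `p` for one unit of debt at loan-to-value ratio `c`. -/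
def collateral (p : ℝ) : ℝ := 1 / (m.c * p)

/-- Expected default of one unit of debt over the next slot. -/
def expectedDefault (p : ℝ) : ℝ := m.priceExp p fun q => max 0 (1 - m.collateral p * q)

/-- Utility of a financing borrower with one unit of debt at price `p` and interest rate `r`
(the expected liquidation at the posted collateral factor is zero). -/
def utilityFinancing (p r : ℝ) : ℝ :=
  m.rExt - r + m.expectedDefault p
    + m.collateral p * m.priceExp p fun q => if q - p < 0 then q - p else 0

/-- Utility of a leveraged trading borrower with one unit of debt at price `p` and interest
rate `r` (the expected liquidation at the posted collateral factor is zero). -/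
def utilityLeveraged (p r : ℝ) : ℝ :=
  -r + m.expectedDefault p + m.priceExp p fun q => (q - p) / p

/-- Expected relative change of the debt over one slot: elasticity times average utility. -/
def drift (p r : ℝ) : ℝ :=
  m.η * (m.α * m.utilityFinancing p r + (1 - m.α) * m.utilityLeveraged p r)

/-- The equilibrium interest rate `r*`, in terms of the price ratio `X = p_{t+1} / p_t`, which is
the next price after price `1`. -/
def equilibriumRate : ℝ :=
  m.α * m.rExt
    + m.priceExp 1 (fun X => max 0 (1 - X / m.c))
    + m.α / m.c * m.priceExp 1 (fun X => if X < 1 then X - 1 else 0)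
    + (1 - m.α) * m.priceExp 1 (fun X => X - 1)

/-- The expected relative change of the debt is `η (r* - r)`; so for `η > 0` the debt is in
equilibrium exactly at the rate `r*`. -/
theorem drift_eq (p r : ℝ) (hp : 0 < p) : m.drift p r = m.η * (m.equilibriumRate - r) := by
  have hc : m.c ≠ 0 := m.c_pos.ne'
  have hp' : p ≠ 0 := hp.ne'
  have h1 : m.expectedDefault p = m.priceExp 1 (fun X => max 0 (1 - X / m.c)) := by
    unfold expectedDefault priceExp collateral nextPrice
    congr 1; ext z; field_simp
  have h2 : m.priceExp p (fun q => (q - p) / p) = m.priceExp 1 (fun X => X - 1) := by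
    unfold priceExp nextPrice
    congr 1; ext z; field_simp
  have h3 : m.priceExp p (fun q => if q - p < 0 then q - p else 0)
      = p * m.priceExp 1 (fun X => if X < 1 then X - 1 else 0) := by
    unfold priceExp nextPrice
    rw [← integral_const_mul]
    congr 1; ext z
    have : p * Real.exp (m.μ + m.σ * z) - p < 0 ↔ 1 * Real.exp (m.μ + m.σ * z) < 1 := by
      rw [sub_neg, one_mul]; exact mul_lt_iff_lt_one_right hp
    simp only [this]
    split_ifs <;> ring
  unfold drift utilityFinancing utilityLeveraged equilibriumRate
  rw [h1, h2, h3, collateral]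
  field_simp
  ring

end Market

/-- Exploration parameters of the interest rate controller. -/
structure Controller where
  /-- exploration probability -/
  ν : unitInterval
  /-- least exploratory rate -/
  rMin : ℝ
  /-- largest exploratory rate -/
  rMax : ℝ
  ν_pos : 0 < ν
  rMin_lt_rMax : rMin < rMax

/-- The randomness of one time slot `(z, ε, b, w)`: price innovation `z`, noise `ε` in the
borrowers' behaviour, exploration coin `b`, exploratory rate `w`. -/
abbrev Slot : Type := ℝ × ℝ × Bool × ℝ

/-- The uniform law of the exploratory rate. -/
def explorationLaw (K : Controller) : Measure ℝ := (volume : Measure ℝ)[|Set.Icc K.rMin K.rMax]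

instance (K : Controller) : IsProbabilityMeasure (explorationLaw K) := by
  refine cond_isProbabilityMeasure_of_finite ?_ ?_ <;> simp [K.rMin_lt_rMax]

/-- Law of the randomness of one slot: the four components are independent. -/
def slotLaw (m : Market) (K : Controller) : Measure Slot :=
  (gaussianReal 0 1).prod ((gaussianReal 0 (m.ζ ^ 2)).prod
    ((bernoulliMeasure true false K.ν).prod (explorationLaw K)))

instance (m : Market) (K : Controller) : IsProbabilityMeasure (slotLaw m K) := by
  unfold slotLaw; infer_instance

/-- Joint law of the randomness of all slots, which are independent and identically distributed. -/
def poolLaw (m : Market) (K : Controller) : Measure (ℕ → Slot) :=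
  Measure.infinitePi fun _ => slotLaw m K

/-- An estimator of the equilibrium rate: `est n r y` is the estimate from the `n` samples
`(r 0, y 0), …, (r (n - 1), y (n - 1))` of an interest rate and the relative change of the debt
that it caused. -/
abbrev Estimator : Type := ℕ → (ℕ → ℝ) → (ℕ → ℝ) → ℝ

/-- The matrix with rows `[1, r i]`, `i < n`. -/
def designMatrix (n : ℕ) (r : ℕ → ℝ) : Matrix (Fin n) (Fin 2) ℝ := Matrix.of fun i => ![1, r i]

/-- Ordinary least squares `(Pᵀ P)⁻¹ Pᵀ ΔB`. -/
def lsCoeff (n : ℕ) (r y : ℕ → ℝ) : Fin 2 → ℝ :=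
  ((designMatrix n r).transpose * designMatrix n r)⁻¹.mulVec
    ((designMatrix n r).transpose.mulVec fun i : Fin n => y i)

open scoped Classical in
/-- Least-squares estimate `-Θ̂(0) / Θ̂(1)` of the equilibrium rate. While it does not exist (the
rates seen so far do not determine `Θ̂`, or `Θ̂(1) = 0`), the current rate is kept. -/
def lsEstimator : Estimator := fun n r y =>
  if IsUnit ((designMatrix n r).transpose * designMatrix n r).det ∧ lsCoeff n r y 1 ≠ 0 then
    -lsCoeff n r y 0 / lsCoeff n r y 1
  else r (n - 1)

/-- Least-squares estimate of the equilibrium rate when the slope `-η` is known: the intercept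
`θ = η r*` is the only unknown, the least-squares solution of `y i = θ - η r i` is the mean of
`y i + η r i`, and the estimate of `r*` is that mean divided by `η`. -/
def knownElasticityEstimator (η : ℝ) : Estimator := fun n r y =>
  (∑ i ∈ Finset.range n, (y i + η * r i)) / n / η

/-- The pool at the beginning of slot `t`. The rates `rate 0, …, rate t` have been set and the
relative debt changes `growth 0, …, growth (t - 1)` have been observed (other entries are unused). -/
structure State where
  /-- price of the collateral asset -/
  price : ℝ
  /-- total debt of the borrowers -/
  debt : ℝ
  /-- interest rates set so far -/
  rate : ℕ → ℝ
  /-- relative changes of the debt observed so far -/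
  growth : ℕ → ℝ

/-- The debt at the end of a slot with interest rate `r` and noise `ε`. -/
def nextDebt (m : Market) (p B r ε : ℝ) : ℝ := B + B * (m.drift p r + ε)

/-- Slot `t`: the borrowers react to `rate t`, the controller adds the sample and sets the next
rate to the new estimate or, if the coin says so, to the exploratory rate. -/
def step (m : Market) (est : Estimator) (t : ℕ) (s : State) (x : Slot) : State :=
  let debt' := nextDebt m s.price s.debt (s.rate t) x.2.1
  let growth' := Function.update s.growth t ((debt' - s.debt) / s.debt)
  { price := m.nextPrice s.price x.1
    debt := debt'
    rate := Function.update s.rate (t + 1)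
      (if x.2.2.1 then x.2.2.2 else est (t + 1) s.rate growth')
    growth := growth' }

/-- The pool under the controller, which starts collecting samples at time `0` with price `p₀`,
debt `B₀` and interest rate `r₀`. -/
def trajectory (m : Market) (est : Estimator) (r₀ p₀ B₀ : ℝ) (ω : ℕ → Slot) : ℕ → State
  | 0 => ⟨p₀, B₀, fun _ => r₀, fun _ => 0⟩
  | t + 1 => step m est t (trajectory m est r₀ p₀ B₀ ω t) (ω t)

/-- The rate `r_τ` set by the controller that stops after `τ` samples: its last estimate. -/
def stoppedRate (m : Market) (est : Estimator) (r₀ p₀ B₀ : ℝ) (τ : ℕ) (ω : ℕ → Slot) : ℝ :=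
  est τ (trajectory m est r₀ p₀ B₀ ω τ).rate (trajectory m est r₀ p₀ B₀ ω τ).growth

/-- `f δ τ` bounds the distance of `r_τ` from the equilibrium rate with probability at least
`1 - δ`, for all `τ` beyond a threshold `T(δ)`. -/
def IsConvergenceBound (m : Market) (K : Controller) (est : Estimator) (r₀ p₀ B₀ : ℝ)
    (f : ℝ → ℕ → ℝ) : Prop :=
  ∀ δ : ℝ, 0 < δ → δ < 1 → ∃ T : ℕ, ∀ τ : ℕ, T < τ →
    1 - δ ≤ (poolLaw m K).real
      {ω | |stoppedRate m est r₀ p₀ B₀ τ ω - m.equilibriumRate| < f δ τ}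

end LendingPool

end

/-! ### Predictable transforms of Gaussian noise. -/

open Filter Topology
open scoped NNReal

noncomputable section

/-! Put `x_s = r_s - r*`. Almost surely the debt never reaches zero, because the noise is atomless,
and then the samples follow the linear model `y_s = -η x_s + ε_s` with noise independent of the
past. Write `A, Q, Z, E` for the empirical means of `x, x², xε, ε`. The least-squares error is `e =
(A Z - Q E) / (-η (Q - A²) + (Z - A E))`. The rates are themselves past estimates, and no moment
bound is available for such ratios, so consistency is proved path by path and only the last step is
distributional.

On a typical path the laws of large numbers hold for the noise and for the exploratory data, and `Z`
is small whenever `Q` is bounded (`IsGaussianNoise.ae_eventually_abs_sum_le`: sub-Gaussian bounds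
after truncating the energy, then Borel–Cantelli). The rest is deterministic (`AdaptiveRegression`).
Exploration forces `Q - A² ≥ c (1 + A²)`. Cauchy–Schwarz handles large variance and the noise law
bounded variance, so the estimates stay bounded. Hence the rates are bounded, `Z → 0` and `e → 0`.
Exploited rates therefore converge to `r*`, and `A, Q` tend to the moments `a, q` of the exploratory
errors, with exploited rates counted as exact.

With `κ = η (q - a²)`, the error times `√n` is now `-κ⁻¹ n^(-1/2) ∑ (a x_s - q) ε_s` up to terms
vanishing in probability. The mean energy of these weights converges to `q (q - a²)`, so the
martingale central limit theorem `tendstoInDistribution_sum` gives a centered Gaussian limit that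
does not depend on the initial data. By `one_sub_exp_lt_gaussianReal`, one constant `C` makes the
limit law of `{|x| < C log (1/δ)}` exceed `1 - δ` strictly for all `δ`, and the portmanteau theorem
carries this to all large `τ`.

When `η` is known, the rates cancel from `y_s + η r_s`. The estimate is `r*` plus the mean noise
over `η`, hence exactly unbiased. -/

/-- Gaussian noise of variance `v` with respect to a filtration: `ε s` is revealed at time `s + 1`
and independent of the information available at time `s`. -/
structure IsGaussianNoise {Ω : Type*} {mΩ : MeasurableSpace Ω} (P : Measure Ω)
    (ℱ : Filtration ℕ mΩ) (ε : ℕ → Ω → ℝ) (v : ℝ≥0) : Prop where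
  measurable_succ : ∀ s, Measurable[ℱ (s + 1)] (ε s)
  map_eq : ∀ s, P.map (ε s) = gaussianReal 0 v
  indep : ∀ s, Indep (ℱ s) (MeasurableSpace.comap (ε s) inferInstance) P

lemma integral_cexp_mul_gaussianReal (z : ℂ) (v : ℝ≥0) :
    ∫ e : ℝ, Complex.exp (z * e) ∂(gaussianReal 0 v) = Complex.exp (z ^ 2 * v / 2) := by
  have h := complexMGF_id_gaussianReal (μ := 0) (v := v) z
  simp only [complexMGF, id] at h
  rw [h]; congr 1; push_cast; ring

namespace IsGaussianNoise

variable {Ω : Type*} {mΩ : MeasurableSpace Ω} {P : Measure Ω}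
  {ℱ : Filtration ℕ mΩ} {ε : ℕ → Ω → ℝ} {v : ℝ≥0}

lemma measurable (hε : IsGaussianNoise P ℱ ε v) (s : ℕ) : Measurable (ε s) :=
  (hε.measurable_succ s).mono (ℱ.le _) le_rfl

lemma measurable_sum (hε : IsGaussianNoise P ℱ ε v) {H : ℕ → Ω → ℝ}
    (hH : ∀ s, Measurable[ℱ s] (H s)) (n : ℕ) :
    Measurable fun ω => ∑ s ∈ Finset.range n, H s ω * ε s ω :=
  Finset.measurable_fun_sum _ fun s _ => ((hH s).mono (ℱ.le _) le_rfl).mul (hε.measurable s)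

variable [IsProbabilityMeasure P]

/-- One step of the exponential martingale of a bounded predictable transform. -/
lemma integral_mul_cexp (hε : IsGaussianNoise P ℱ ε v) (s : ℕ) {F : Ω → ℂ} {H : Ω → ℝ}
    (hF : Measurable[ℱ s] F) (hFi : Integrable F P) (hH : Measurable[ℱ s] H) {b : ℝ}
    (hb : ∀ ω, |H ω| ≤ b) (z : ℂ) :
    Integrable (fun ω => F ω * Complex.exp (z * (H ω * ε s ω) - z ^ 2 * v / 2 * H ω ^ 2)) P ∧
    ∫ ω, F ω * Complex.exp (z * (H ω * ε s ω) - z ^ 2 * v / 2 * H ω ^ 2) ∂P = ∫ ω, F ω ∂P := by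
  let X : Ω → ℂ × ℝ := fun ω => (F ω, H ω)
  have hX : Measurable[ℱ s] X := hF.prodMk hH
  have hX' : Measurable X := hX.mono (ℱ.le _) le_rfl
  have hind : IndepFun X (ε s) P := by
    rw [IndepFun_iff_Indep]
    exact indep_of_indep_of_le_left (hε.indep s) hX.comap_le
  have hmap := (indepFun_iff_map_prod_eq_prod_map_map hX'.aemeasurable
    (hε.measurable s).aemeasurable).1 hind
  rw [hε.map_eq] at hmap
  let g : (ℂ × ℝ) × ℝ → ℂ := fun p =>
    p.1.1 * Complex.exp (z * (p.1.2 * p.2) - z ^ 2 * v / 2 * p.1.2 ^ 2)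
  have hg : Continuous g := by fun_prop
  have hprod : Measurable fun ω => (X ω, ε s ω) := hX'.prodMk (hε.measurable s)
  have : IsProbabilityMeasure (P.map X) := Measure.isProbabilityMeasure_map hX'.aemeasurable
  have hsplit : ∀ (p : ℂ × ℝ) (e : ℝ), g (p, e) =
      (p.1 * Complex.exp (- (z ^ 2 * v / 2 * p.2 ^ 2))) * Complex.exp ((z * p.2) * e) := by
    intro p e
    simp only [g]
    rw [mul_assoc, ← Complex.exp_add]; congr 2; ring
  have hinner : ∀ p : ℂ × ℝ, ∫ e, g (p, e) ∂(gaussianReal 0 v) = p.1 := by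
    intro p
    simp_rw [hsplit]
    rw [integral_const_mul, integral_cexp_mul_gaussianReal, mul_assoc, ← Complex.exp_add]
    rw [show -(z ^ 2 * (v : ℂ) / 2 * (p.2 : ℂ) ^ 2) + (z * p.2) ^ 2 * v / 2 = 0 by ring]
    simp
  have hnorm : ∀ (p : ℂ × ℝ) (e : ℝ), ‖g (p, e)‖ =
      (‖p.1‖ * Real.exp (- ((z ^ 2).re * v / 2 * p.2 ^ 2))) * Real.exp ((z.re * p.2) * e) := by
    intro p e
    rw [hsplit, norm_mul, norm_mul, Complex.norm_exp, Complex.norm_exp]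
    congr 2
    · congr 1
      rw [Complex.neg_re, show z ^ 2 * (v : ℂ) / 2 * (p.2 : ℂ) ^ 2
        = (((v : ℝ) / 2 * p.2 ^ 2 : ℝ) : ℂ) * z ^ 2 by push_cast; ring, Complex.re_ofReal_mul]
      ring
    · rw [show z * (p.2 : ℂ) * (e : ℂ) = ((p.2 * e : ℝ) : ℂ) * z by push_cast; ring,
        Complex.re_ofReal_mul]
      ring
  have hinnorm : ∀ p : ℂ × ℝ, ∫ e, ‖g (p, e)‖ ∂(gaussianReal 0 v)
      = ‖p.1‖ * Real.exp (z.im ^ 2 * v / 2 * p.2 ^ 2) := by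
    intro p
    simp_rw [hnorm]
    rw [integral_const_mul]
    have := congrFun (mgf_fun_id_gaussianReal (μ := 0) (v := v)) (z.re * p.2)
    simp only [mgf] at this
    rw [this, mul_assoc, ← Real.exp_add]
    congr 2
    simp only [sq, Complex.mul_re]; ring
  -- The inner integral of the norm is `‖F‖ exp (z.im² v H² / 2)`; for non-real `z` this is where
  -- the bound on `H` enters.
  have hgi : Integrable g ((P.map X).prod (gaussianReal 0 v)) := by
    rw [integrable_prod_iff hg.aestronglyMeasurable]
    constructor
    · refine ae_of_all _ fun p => ?_
      rw [← integrable_norm_iff (by fun_prop)]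
      simp_rw [hnorm]
      exact (integrable_exp_mul_gaussianReal _).const_mul _
    · simp_rw [hinnorm]
      rw [integrable_map_measure (by fun_prop) hX'.aemeasurable]
      refine Integrable.mono' (hFi.norm.mul_const (Real.exp (z.im ^ 2 * v / 2 * b ^ 2))) ?_ ?_
      · exact (by fun_prop : Continuous fun p : ℂ × ℝ =>
          ‖p.1‖ * Real.exp (z.im ^ 2 * v / 2 * p.2 ^ 2)).measurable.comp hX' |>.aestronglyMeasurable
      · refine ae_of_all _ fun ω => ?_
        simp only [Function.comp, X]
        rw [Real.norm_of_nonneg (by positivity)]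
        gcongr ‖F ω‖ * Real.exp (_ * ?_)
        exact sq_le_sq' (neg_le_of_abs_le (hb ω)) (le_of_abs_le (hb ω))
  constructor
  · rw [← hmap] at hgi
    exact hgi.comp_measurable hprod
  · calc _ = ∫ ω, g (X ω, ε s ω) ∂P := rfl
      _ = ∫ p, g p ∂(P.map fun ω => (X ω, ε s ω)) :=
        (integral_map hprod.aemeasurable hg.aestronglyMeasurable).symm
      _ = ∫ p, p.1 ∂(P.map X) := by
        rw [hmap, integral_prod _ hgi]; simp_rw [hinner]
      _ = _ := integral_map hX'.aemeasurable (by fun_prop)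

lemma integral_cexp_sum (hε : IsGaussianNoise P ℱ ε v) {H : ℕ → Ω → ℝ}
    (hH : ∀ s, Measurable[ℱ s] (H s)) {b : ℝ} (hb : ∀ s ω, |H s ω| ≤ b) (z : ℂ) (n : ℕ) :
    Integrable (fun ω => Complex.exp (z * (∑ s ∈ Finset.range n, H s ω * ε s ω : ℝ)
      - z ^ 2 * v / 2 * (∑ s ∈ Finset.range n, H s ω ^ 2 : ℝ))) P ∧
    ∫ ω, Complex.exp (z * (∑ s ∈ Finset.range n, H s ω * ε s ω : ℝ)
      - z ^ 2 * v / 2 * (∑ s ∈ Finset.range n, H s ω ^ 2 : ℝ)) ∂P = 1 := by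
  induction n with
  | zero => simp
  | succ n ih =>
    have hmeas : Measurable[ℱ n] fun ω =>
        Complex.exp (z * (∑ s ∈ Finset.range n, H s ω * ε s ω : ℝ)
          - z ^ 2 * v / 2 * (∑ s ∈ Finset.range n, H s ω ^ 2 : ℝ)) := by
      have h1 : Measurable[ℱ n] fun ω => ∑ s ∈ Finset.range n, H s ω * ε s ω :=
        Finset.measurable_fun_sum _ fun s hs =>
          ((hH s).mono (ℱ.mono (Finset.mem_range.1 hs).le) le_rfl).mul
            ((hε.measurable_succ s).mono (ℱ.mono (Finset.mem_range.1 hs)) le_rfl)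
      have h2 : Measurable[ℱ n] fun ω => ∑ s ∈ Finset.range n, H s ω ^ 2 :=
        Finset.measurable_fun_sum _ fun s hs =>
          ((hH s).mono (ℱ.mono (Finset.mem_range.1 hs).le) le_rfl).pow_const 2
      exact (by fun_prop : Continuous fun p : ℝ × ℝ =>
        Complex.exp (z * p.1 - z ^ 2 * v / 2 * p.2)).measurable.comp (h1.prodMk h2)
    have h := hε.integral_mul_cexp n hmeas ih.1 (hH n) (hb n) z
    have heq : ∀ ω, Complex.exp (z * (∑ s ∈ Finset.range (n + 1), H s ω * ε s ω : ℝ)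
        - z ^ 2 * v / 2 * (∑ s ∈ Finset.range (n + 1), H s ω ^ 2 : ℝ)) =
        Complex.exp (z * (∑ s ∈ Finset.range n, H s ω * ε s ω : ℝ)
          - z ^ 2 * v / 2 * (∑ s ∈ Finset.range n, H s ω ^ 2 : ℝ))
        * Complex.exp (z * (H n ω * ε n ω) - z ^ 2 * v / 2 * H n ω ^ 2) := by
      intro ω
      rw [← Complex.exp_add, Finset.sum_range_succ, Finset.sum_range_succ]
      congr 1; push_cast; ring
    simp_rw [heq]
    exact ⟨h.1, h.2.trans ih.2⟩

/-- The exponential martingale at real `z = t` has mean one, and a deterministic bound on the energy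
lets its compensator be pulled out as a constant. -/
lemma hasSubgaussianMGF_sum (hε : IsGaussianNoise P ℱ ε v) {H : ℕ → Ω → ℝ}
    (hH : ∀ s, Measurable[ℱ s] (H s)) {b : ℝ} (hb : ∀ s ω, |H s ω| ≤ b) (n : ℕ) {A : ℝ≥0}
    (hA : ∀ ω, ∑ s ∈ Finset.range n, H s ω ^ 2 ≤ A) :
    HasSubgaussianMGF (fun ω => ∑ s ∈ Finset.range n, H s ω * ε s ω) (v * A) P := by
  have key : ∀ t : ℝ, Integrable (fun ω => Real.exp (t * (∑ s ∈ Finset.range n, H s ω * ε s ω)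
      - t ^ 2 * v / 2 * (∑ s ∈ Finset.range n, H s ω ^ 2))) P ∧
      ∫ ω, Real.exp (t * (∑ s ∈ Finset.range n, H s ω * ε s ω)
      - t ^ 2 * v / 2 * (∑ s ∈ Finset.range n, H s ω ^ 2)) ∂P = 1 := by
    intro t
    have h := hε.integral_cexp_sum hH hb t n
    have heq : ∀ ω, Complex.exp (t * (∑ s ∈ Finset.range n, H s ω * ε s ω : ℝ)
      - (t : ℂ) ^ 2 * v / 2 * (∑ s ∈ Finset.range n, H s ω ^ 2 : ℝ)) =
      ((Real.exp (t * (∑ s ∈ Finset.range n, H s ω * ε s ω)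
      - t ^ 2 * v / 2 * (∑ s ∈ Finset.range n, H s ω ^ 2)) : ℝ) : ℂ) := by
      intro ω; push_cast; rfl
    simp_rw [heq] at h
    refine ⟨h.1.re, ?_⟩
    have h2 := h.2
    rw [integral_complex_ofReal] at h2
    exact_mod_cast h2
  have hle : ∀ (t : ℝ) ω, Real.exp (t * (∑ s ∈ Finset.range n, H s ω * ε s ω)) ≤
      Real.exp ((v * A : ℝ≥0) * t ^ 2 / 2) *
      Real.exp (t * (∑ s ∈ Finset.range n, H s ω * ε s ω)
      - t ^ 2 * v / 2 * (∑ s ∈ Finset.range n, H s ω ^ 2)) := by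
    intro t ω
    rw [← Real.exp_add]
    apply Real.exp_le_exp.2
    have := mul_le_mul_of_nonneg_left (hA ω) (by positivity : 0 ≤ t ^ 2 * (v : ℝ) / 2)
    push_cast
    linarith
  have hint : ∀ t : ℝ, Integrable
      (fun ω => Real.exp (t * (∑ s ∈ Finset.range n, H s ω * ε s ω))) P := by
    intro t
    refine Integrable.mono' ((key t).1.const_mul (Real.exp ((v * A : ℝ≥0) * t ^ 2 / 2)))
      ((hε.measurable_sum hH n).const_mul t).exp.aestronglyMeasurable (ae_of_all _ fun ω => ?_)
    rw [Real.norm_of_nonneg (Real.exp_nonneg _)]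
    exact hle t ω
  refine ⟨hint, fun t => ?_⟩
  calc _ ≤ ∫ ω, Real.exp ((v * A : ℝ≥0) * t ^ 2 / 2) *
      Real.exp (t * (∑ s ∈ Finset.range n, H s ω * ε s ω)
      - t ^ 2 * v / 2 * (∑ s ∈ Finset.range n, H s ω ^ 2)) ∂P :=
        integral_mono (hint t) ((key t).1.const_mul _) (hle t)
    _ = _ := by rw [integral_const_mul, (key t).2, mul_one]

end IsGaussianNoise

/-! ### Truncation by energy, strong law and central limit theorem. -/

/-- The process `h`, stopped before its sum of squares exceeds `A`. -/
def energyTruncation {Ω : Type*} (h : ℕ → Ω → ℝ) (A : ℝ) (s : ℕ) (ω : Ω) : ℝ :=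
  if ∑ u ∈ Finset.range (s + 1), h u ω ^ 2 ≤ A then h s ω else 0

section EnergyTruncation

variable {Ω : Type*} {h : ℕ → Ω → ℝ} {A : ℝ} {ω : Ω}

lemma energyTruncation_eq {n s : ℕ} (hn : ∑ u ∈ Finset.range n, h u ω ^ 2 ≤ A) (hs : s < n) :
    energyTruncation h A s ω = h s ω := by
  refine if_pos (le_trans ?_ hn)
  exact Finset.sum_le_sum_of_subset_of_nonneg (Finset.range_subset_range.2 hs)
    fun _ _ _ => sq_nonneg _

/-- Partial energies are monotone: either the level has not been passed and nothing is truncated, or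
the last term is zero. -/
lemma sum_energyTruncation_sq_le (hA : 0 ≤ A) (n : ℕ) :
    ∑ s ∈ Finset.range n, energyTruncation h A s ω ^ 2 ≤ A := by
  induction n with
  | zero => simpa
  | succ n ih =>
    by_cases hc : ∑ u ∈ Finset.range (n + 1), h u ω ^ 2 ≤ A
    · rwa [Finset.sum_congr rfl fun s hs =>
        by rw [energyTruncation_eq hc (Finset.mem_range.1 hs)]]
    · rw [Finset.sum_range_succ]
      simpa [energyTruncation, hc] using ih

lemma abs_energyTruncation_le (hA : 0 ≤ A) (s : ℕ) : |energyTruncation h A s ω| ≤ √A := by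
  refine Real.abs_le_sqrt (le_trans ?_ (sum_energyTruncation_sq_le (h := h) (ω := ω) hA (s + 1)))
  exact Finset.single_le_sum (f := fun s => energyTruncation h A s ω ^ 2)
    (fun _ _ => sq_nonneg _) (Finset.self_mem_range_succ s)

/-- The test at time `s` includes `h s` itself, which is already known at time `s`; truncation
therefore keeps the process predictable. -/
lemma measurable_energyTruncation {mΩ : MeasurableSpace Ω} {ℱ : Filtration ℕ mΩ}
    (hh : ∀ s, Measurable[ℱ s] (h s)) (s : ℕ) : Measurable[ℱ s] (energyTruncation h A s) := by
  refine Measurable.ite (measurableSet_le (Finset.measurable_fun_sum _ fun u hu => ?_)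
    measurable_const) (hh s) measurable_const
  exact ((hh u).mono (ℱ.mono (Nat.lt_succ_iff.1 (Finset.mem_range.1 hu))) le_rfl).pow_const 2

end EnergyTruncation

namespace IsGaussianNoise

variable {Ω : Type*} {mΩ : MeasurableSpace Ω} {P : Measure Ω} [IsProbabilityMeasure P]
  {ℱ : Filtration ℕ mΩ} {ε : ℕ → Ω → ℝ} {v : ℝ≥0}

/-- Energy at most `K n` makes the sum sub-Gaussian with parameter `v K n`, so a deviation `κ n` has
probability at most `2 exp (-κ² n / (2 v K))`. This is summable, and Borel–Cantelli applies even
though the truncation level changes with `n`. -/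
lemma ae_eventually_abs_sum_energyTruncation_lt (hε : IsGaussianNoise P ℱ ε v) (hv : v ≠ 0)
    {h : ℕ → Ω → ℝ} (hh : ∀ s, Measurable[ℱ s] (h s)) {K : ℝ≥0} (hK : 0 < K) {κ : ℝ} (hκ : 0 < κ) :
    ∀ᵐ ω ∂P, ∀ᶠ n : ℕ in atTop,
      |∑ s ∈ Finset.range n, energyTruncation h (K * n) s ω * ε s ω| < κ * n := by
  have hv' : 0 < (v : ℝ) := by positivity
  have hK' : 0 < (K : ℝ) := by positivity
  set c : ℝ := κ ^ 2 / (2 * (v * K)) with hc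
  have hcpos : 0 < c := by positivity
  have hbound : ∀ n : ℕ,
      P {ω | κ * n ≤ |∑ s ∈ Finset.range n, energyTruncation h (K * n) s ω * ε s ω|}
        ≤ ENNReal.ofReal (2 * Real.exp (-c) ^ n) := by
    intro n
    rcases Nat.eq_zero_or_pos n with rfl | hn
    · refine prob_le_one.trans ?_
      rw [← ENNReal.ofReal_one]; exact ENNReal.ofReal_le_ofReal (by norm_num)
    have hn' : (0 : ℝ) < n := by exact_mod_cast hn
    have hsub := hε.hasSubgaussianMGF_sum (H := energyTruncation h (K * n))
      (measurable_energyTruncation hh) (fun s ω => abs_energyTruncation_le (by positivity) s) n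
      (A := K * n) (fun ω => by push_cast; exact sum_energyTruncation_sq_le (by positivity) n)
    have hexp : Real.exp (-(κ * n) ^ 2 / (2 * ((v * (K * n) : ℝ≥0) : ℝ))) = Real.exp (-c) ^ n := by
      rw [← Real.exp_nat_mul]
      congr 1
      rw [hc]; push_cast; field_simp
    have h1 := hsub.measure_ge_le (ε := κ * n) (by positivity)
    have h2 := hsub.neg.measure_ge_le (ε := κ * n) (by positivity)
    rw [hexp] at h1 h2
    rw [ENNReal.le_ofReal_iff_toReal_le (measure_ne_top _ _) (by positivity), ← measureReal_def]
    calc _ ≤ P.real ({ω | κ * n ≤ ∑ s ∈ Finset.range n, energyTruncation h (K * n) s ω * ε s ω} ∪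
          {ω | κ * n ≤ (-fun ω => ∑ s ∈ Finset.range n, energyTruncation h (K * n) s ω * ε s ω) ω})
            := measureReal_mono fun ω (hω : κ * n ≤ |_|) => le_abs.1 hω
      _ ≤ _ := measureReal_union_le _ _
      _ ≤ Real.exp (-c) ^ n + Real.exp (-c) ^ n := add_le_add h1 h2
      _ = _ := (two_mul _).symm
  have hsum : ∑' n : ℕ,
      P {ω | κ * n ≤ |∑ s ∈ Finset.range n, energyTruncation h (K * n) s ω * ε s ω|} ≠ ⊤ := by
    refine ne_top_of_le_ne_top ?_ (ENNReal.tsum_le_tsum hbound)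
    rw [← ENNReal.ofReal_tsum_of_nonneg (fun n => by positivity)]
    · exact ENNReal.ofReal_ne_top
    · exact (summable_geometric_of_lt_one (Real.exp_nonneg _)
        (Real.exp_lt_one_iff.2 (neg_neg_of_pos hcpos))).mul_left 2
  filter_upwards [ae_eventually_notMem hsum] with ω hω
  filter_upwards [hω] with n hn
  simpa using hn

/-- Strong law for transforms of the noise: where the energy grows at most linearly, the transform
is eventually `o(n)`. -/
lemma ae_eventually_abs_sum_le (hε : IsGaussianNoise P ℱ ε v) (hv : v ≠ 0)
    {h : ℕ → Ω → ℝ} (hh : ∀ s, Measurable[ℱ s] (h s)) :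
    ∀ᵐ ω ∂P, ∀ K κ : ℝ, 0 < κ → ∀ᶠ n : ℕ in atTop,
      ∑ s ∈ Finset.range n, h s ω ^ 2 ≤ K * n →
      |∑ s ∈ Finset.range n, h s ω * ε s ω| ≤ κ * n := by
  -- Countably many levels `k + 1` and tolerances `1 / (j + 1)` give one null set that serves all
  -- real `K` and `κ`.
  have hall : ∀ᵐ ω ∂P, ∀ k j : ℕ, ∀ᶠ n : ℕ in atTop,
      |∑ s ∈ Finset.range n, energyTruncation h (((k + 1 : ℕ) : ℝ≥0) * n) s ω * ε s ω|
        < 1 / ((j : ℝ) + 1) * n :=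
    ae_all_iff.2 fun k => ae_all_iff.2 fun j =>
      hε.ae_eventually_abs_sum_energyTruncation_lt hv hh (by positivity) (by positivity)
  filter_upwards [hall] with ω hω K κ hκ
  obtain ⟨k, hk⟩ := exists_nat_ge K
  obtain ⟨j, hj⟩ := exists_nat_one_div_lt hκ
  filter_upwards [hω k j] with n hn hKn
  have hKn' : ∑ s ∈ Finset.range n, h s ω ^ 2 ≤ (((k + 1 : ℕ) : ℝ≥0) : ℝ) * n := by
    refine hKn.trans ?_
    push_cast
    gcongr
    linarith
  rw [Finset.sum_congr rfl fun s hs => by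
    rw [energyTruncation_eq hKn' (Finset.mem_range.1 hs)]] at hn
  exact hn.le.trans (by gcongr)

/-- Central limit theorem for transforms of Gaussian noise whose mean energy converges. -/
theorem tendstoInDistribution_sum (hε : IsGaussianNoise P ℱ ε v)
    {h : ℕ → Ω → ℝ} (hh : ∀ s, Measurable[ℱ s] (h s)) {q : ℝ≥0}
    (hq : ∀ᵐ ω ∂P, Tendsto (fun n : ℕ => (∑ s ∈ Finset.range n, h s ω ^ 2) / n) atTop (𝓝 q)) :
    TendstoInDistribution (fun (n : ℕ) ω => (∑ s ∈ Finset.range n, h s ω * ε s ω) / √n) atTop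
      id (fun _ => P) (gaussianReal 0 (v * q)) := by
  have hmeas : ∀ n : ℕ, Measurable fun ω => (∑ s ∈ Finset.range n, h s ω * ε s ω) / √n :=
    fun n => (hε.measurable_sum hh n).div_const _
  refine ⟨fun n => (hmeas n).aemeasurable, aemeasurable_id, ?_⟩
  refine ProbabilityMeasure.tendsto_iff_tendsto_charFun.2 fun t => ?_
  simp only [ProbabilityMeasure.coe_mk, Measure.map_id, charFun_apply_real]
  -- The mean energy tends to `q`, so almost surely truncation at `(q + 1) n` is eventually
  -- inactive; meanwhile it provides the bounds for dominated convergence.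
  set T : ℕ → ℕ → Ω → ℝ := fun n => energyTruncation h ((q + 1) * n) with hT
  have hTm : ∀ n s, Measurable[ℱ s] (T n s) := fun n s => measurable_energyTruncation hh s
  set G : ℕ → Ω → ℂ := fun n ω => Complex.exp (Complex.I * t / (√n : ℝ) *
      (∑ s ∈ Finset.range n, T n s ω * ε s ω : ℝ)
      - (Complex.I * t / (√n : ℝ)) ^ 2 * v / 2 * (∑ s ∈ Finset.range n, T n s ω ^ 2 : ℝ)) with hG
  have hGint : ∀ n, Integrable (G n) P ∧ ∫ ω, G n ω ∂P = 1 := fun n =>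
    hε.integral_cexp_sum (hTm n) (fun s ω => abs_energyTruncation_le (by positivity) s) _ n
  have hE : ∀ n : ℕ, ∫ x : ℝ, Complex.exp (t * x * Complex.I)
      ∂(P.map fun ω => (∑ s ∈ Finset.range n, h s ω * ε s ω) / √n) =
      ∫ ω, Complex.exp (t * ((∑ s ∈ Finset.range n, h s ω * ε s ω) / √n : ℝ) * Complex.I) ∂P :=
    fun n => integral_map (hmeas n).aemeasurable (by fun_prop)
  simp_rw [hE]
  set c : ℂ := Complex.exp (-(t ^ 2 * v * q / 2 : ℝ)) with hc
  have hlim : ∫ x : ℝ, Complex.exp (t * x * Complex.I) ∂(gaussianReal 0 (v * q)) = c := by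
    rw [hc, ← charFun_apply_real, charFun_gaussianReal]; congr 1; push_cast; ring
  rw [hlim]
  have hEint : ∀ n : ℕ, Integrable (fun ω => Complex.exp
      (t * ((∑ s ∈ Finset.range n, h s ω * ε s ω) / √n : ℝ) * Complex.I)) P := by
    intro n
    refine Integrable.of_bound (C := 1) (((by fun_prop : Continuous fun x : ℝ =>
      Complex.exp (t * x * Complex.I)).measurable.comp (hmeas n)).aestronglyMeasurable)
      (ae_of_all _ fun ω => ?_)
    rw [← Complex.ofReal_mul, Complex.norm_exp_ofReal_mul_I]
  rw [← tendsto_sub_nhds_zero_iff]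
  -- Since `G n` has mean one, the limit `c` may be written as the mean of `G n * c`. Once
  -- truncation is inactive, the two integrands share the oscillating phase and differ only through
  -- the compensator, which converges pathwise.
  have hsub : ∀ n : ℕ, ∫ ω, Complex.exp
      (t * ((∑ s ∈ Finset.range n, h s ω * ε s ω) / √n : ℝ) * Complex.I) ∂P - c =
      ∫ ω, (Complex.exp
      (t * ((∑ s ∈ Finset.range n, h s ω * ε s ω) / √n : ℝ) * Complex.I) - G n ω * c) ∂P := by
    intro n
    rw [integral_sub (hEint n) ((hGint n).1.mul_const c), integral_mul_const, (hGint n).2, one_mul]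
  simp_rw [hsub]
  have hGeq : ∀ n : ℕ, 0 < n → ∀ ω, G n ω = Complex.exp
      (t * ((∑ s ∈ Finset.range n, T n s ω * ε s ω) / √n : ℝ) * Complex.I) *
      (Real.exp (t ^ 2 * v / 2 * ((∑ s ∈ Finset.range n, T n s ω ^ 2) / n)) : ℝ) := by
    intro n hn ω
    have hs : ((√n : ℝ) : ℂ) ^ 2 = (n : ℂ) := by
      rw [← Complex.ofReal_pow, Real.sq_sqrt (Nat.cast_nonneg n)]; simp
    rw [hG, Complex.ofReal_exp, ← Complex.exp_add]
    simp only
    congr 1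
    rw [div_pow, hs, mul_pow, Complex.I_sq]
    push_cast
    ring
  rw [← integral_zero (α := Ω) (μ := P) (G := ℂ)]
  refine tendsto_integral_filter_of_dominated_convergence
    (fun _ => 1 + Real.exp (t ^ 2 * v / 2 * (q + 1))) ?_ ?_ (integrable_const _) ?_
  · exact Eventually.of_forall fun n =>
      ((hEint n).sub ((hGint n).1.mul_const c)).aestronglyMeasurable
  · filter_upwards [eventually_gt_atTop 0] with n hn
    refine ae_of_all _ fun ω => ?_
    have hn' : (0 : ℝ) < n := by exact_mod_cast hn
    refine (norm_sub_le _ _).trans ?_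
    rw [norm_mul, hGeq n hn, norm_mul, ← Complex.ofReal_mul, Complex.norm_exp_ofReal_mul_I,
      ← Complex.ofReal_mul, Complex.norm_exp_ofReal_mul_I, one_mul, Complex.norm_real,
      Real.norm_of_nonneg (Real.exp_nonneg _)]
    have h1 : ‖c‖ ≤ 1 := by
      rw [hc, ← Complex.ofReal_neg, ← Complex.ofReal_exp, Complex.norm_real,
        Real.norm_of_nonneg (Real.exp_nonneg _)]
      exact Real.exp_le_one_iff.2 (neg_nonpos.2 (by positivity))
    have h2 : (∑ s ∈ Finset.range n, T n s ω ^ 2) / n ≤ q + 1 := by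
      rw [div_le_iff₀ hn']
      exact sum_energyTruncation_sq_le (by positivity) n
    gcongr
    calc _ ≤ Real.exp (t ^ 2 * v / 2 * (q + 1)) * 1 := by gcongr
      _ = _ := mul_one _
  · filter_upwards [hq] with ω hω
    have hev : ∀ᶠ n : ℕ in atTop, (∑ s ∈ Finset.range n, h s ω ^ 2) / n < q + 1 :=
      hω.eventually_lt_const (lt_add_one _)
    have hfac : Tendsto (fun n : ℕ => ((1 - Real.exp (t ^ 2 * v / 2 *
        ((∑ s ∈ Finset.range n, h s ω ^ 2) / n) - t ^ 2 * v * q / 2) : ℝ) : ℂ)) atTop (𝓝 0) := by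
      have := ((((hω.const_mul (t ^ 2 * v / 2)).sub_const (t ^ 2 * v * q / 2)).rexp).const_sub 1)
      rw [show t ^ 2 * (v : ℝ) / 2 * q - t ^ 2 * v * q / 2 = 0 by ring, Real.exp_zero,
        sub_self] at this
      exact_mod_cast (Complex.continuous_ofReal.tendsto 0).comp this
    rw [tendsto_zero_iff_norm_tendsto_zero] at hfac ⊢
    refine hfac.congr' ?_
    filter_upwards [hev, eventually_gt_atTop 0] with n hn hn0
    have hn' : (0 : ℝ) < n := by exact_mod_cast hn0
    have hle : ∑ s ∈ Finset.range n, h s ω ^ 2 ≤ (q + 1) * n := ((div_lt_iff₀ hn').1 hn).le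
    have hTh : ∀ s ∈ Finset.range n, T n s ω = h s ω := fun s hs =>
      energyTruncation_eq hle (Finset.mem_range.1 hs)
    have hS1 : ∑ s ∈ Finset.range n, T n s ω * ε s ω = ∑ s ∈ Finset.range n, h s ω * ε s ω :=
      Finset.sum_congr rfl fun s hs => by rw [hTh s hs]
    have hS2 : ∑ s ∈ Finset.range n, T n s ω ^ 2 = ∑ s ∈ Finset.range n, h s ω ^ 2 :=
      Finset.sum_congr rfl fun s hs => by rw [hTh s hs]
    rw [hGeq n hn0, hS1, hS2, mul_assoc (Complex.exp _),
      show ∀ a b : ℂ, a - a * b = a * (1 - b) by intros; ring, norm_mul, ← Complex.ofReal_mul t,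
      Complex.norm_exp_ofReal_mul_I, one_mul, hc, ← Complex.ofReal_neg, ← Complex.ofReal_exp,
      ← Complex.ofReal_mul, ← Real.exp_add, ← Complex.ofReal_one, ← Complex.ofReal_sub,
      ← sub_eq_add_neg]

end IsGaussianNoise

/-! ### Empirical means. -/

/-- The mean of the first `n` terms of a sequence. -/
def empMean (f : ℕ → ℝ) (n : ℕ) : ℝ := (∑ s ∈ Finset.range n, f s) / n

section EmpMean

variable {f g : ℕ → ℝ} {n : ℕ}

lemma empMean_add : empMean (fun s => f s + g s) n = empMean f n + empMean g n := by
  simp [empMean, Finset.sum_add_distrib, add_div]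

lemma empMean_sub : empMean (fun s => f s - g s) n = empMean f n - empMean g n := by
  simp [empMean, Finset.sum_sub_distrib, sub_div]

lemma empMean_const_mul (c : ℝ) : empMean (fun s => c * f s) n = c * empMean f n := by
  simp [empMean, ← Finset.mul_sum, mul_div_assoc]

lemma empMean_const (c : ℝ) (hn : 0 < n) : empMean (fun _ => c) n = c := by
  have : (n : ℝ) ≠ 0 := by positivity
  simp [empMean]; field_simp

lemma empMean_mono (h : ∀ s, f s ≤ g s) : empMean f n ≤ empMean g n := by
  unfold empMean
  gcongr with s
  exact h s

lemma tendsto_empMean {l : ℝ} (h : Tendsto f atTop (𝓝 l)) : Tendsto (empMean f) atTop (𝓝 l) := by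
  refine h.cesaro.congr fun n => ?_
  rw [empMean, div_eq_inv_mul]

lemma tendsto_empMean_of_sub {l : ℝ} (hg : Tendsto (empMean g) atTop (𝓝 l))
    (h : Tendsto (fun s => f s - g s) atTop (𝓝 0)) : Tendsto (empMean f) atTop (𝓝 l) := by
  have := (tendsto_empMean h).add hg
  rw [zero_add] at this
  refine this.congr fun n => ?_
  rw [empMean_sub]; ring

/-- Needed because the coin of slot `s` decides the rate of slot `s + 1`. -/
lemma tendsto_empMean_shift {l : ℝ} (h : Tendsto (empMean f) atTop (𝓝 l)) (hg0 : g 0 = 0)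
    (hg : ∀ s, g (s + 1) = f s) : Tendsto (empMean g) atTop (𝓝 l) := by
  rw [← tendsto_add_atTop_iff_nat 1]
  have h1 := h.mul (tendsto_natCast_div_add_atTop (1 : ℝ))
  rw [mul_one] at h1
  refine h1.congr' ?_
  filter_upwards [eventually_gt_atTop 0] with n hn
  have : (n : ℝ) ≠ 0 := by positivity
  have h2 : (n : ℝ) + 1 ≠ 0 := by positivity
  simp only [empMean, Finset.sum_range_succ', hg0, add_zero, hg]
  push_cast
  field_simp

lemma sq_empMean_mul_le : empMean (fun s => f s * g s) n ^ 2
    ≤ empMean (fun s => f s ^ 2) n * empMean (fun s => g s ^ 2) n := by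
  simp only [empMean, div_pow, div_mul_div_comm, ← sq]
  gcongr
  exact Finset.sum_mul_sq_le_sq_mul_sq _ _ _

end EmpMean

lemma exists_pos_lt_mul_sub {a q ν : ℝ} (hq : 0 < q) (hν : 0 < ν) (h : a ^ 2 < ν * q) :
    ∃ c : ℝ, 0 < c ∧ c < q ∧ c < ν ∧ a ^ 2 < (ν - c) * (q - c) := by
  have h1 : Tendsto (fun c : ℝ => (ν - c) * (q - c)) (𝓝[>] 0) (𝓝 (ν * q)) := by
    have : Continuous fun c : ℝ => (ν - c) * (q - c) := by fun_prop
    simpa using (this.tendsto 0).mono_left nhdsWithin_le_nhds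
  have h2 : Tendsto (fun c : ℝ => c) (𝓝[>] 0) (𝓝 0) := tendsto_id.mono_left nhdsWithin_le_nhds
  obtain ⟨c, hc⟩ := ((h1.eventually_const_lt h).and ((h2.eventually_lt_const hq).and
    ((h2.eventually_lt_const hν).and self_mem_nhdsWithin))).exists
  exact ⟨c, hc.2.2.2, hc.2.1, hc.2.2.1, hc.1⟩

/-! ### Deterministic analysis of a typical trajectory. -/

/-- Deterministic setting: errors `x` of the rates, noise `ε`, exploration indicator `β` of the
rate, and error `e` of the least-squares estimates, along a typical trajectory. -/
structure AdaptiveRegression (η ν a q v R : ℝ) (x ε β e : ℕ → ℝ) : Prop where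
  η_pos : 0 < η
  ν_pos : 0 < ν
  q_pos : 0 < q
  lt : a ^ 2 < ν * q
  indicator : ∀ s, β s = 0 ∨ β s = 1
  explored_le : ∀ s, |β s * x s| ≤ R
  exploited_eq : ∀ s, 1 ≤ s → (1 - β s) * x s = (1 - β s) * e s
  estimate_eq : ∀ n, 1 ≤ n →
    empMean (fun s => x s ^ 2) n - empMean x n ^ 2 ≠ 0 →
    -η * (empMean (fun s => x s ^ 2) n - empMean x n ^ 2)
      + (empMean (fun s => x s * ε s) n - empMean x n * empMean ε n) ≠ 0 →
    e n = (empMean x n * empMean (fun s => x s * ε s) n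
        - empMean (fun s => x s ^ 2) n * empMean ε n) /
      (-η * (empMean (fun s => x s ^ 2) n - empMean x n ^ 2)
        + (empMean (fun s => x s * ε s) n - empMean x n * empMean ε n))
  tendsto_noise : Tendsto (empMean ε) atTop (𝓝 0)
  tendsto_noise_sq : Tendsto (empMean fun s => ε s ^ 2) atTop (𝓝 v)
  tendsto_indicator : Tendsto (empMean β) atTop (𝓝 ν)
  tendsto_explored : Tendsto (empMean fun s => β s * x s) atTop (𝓝 a)
  tendsto_explored_sq : Tendsto (empMean fun s => β s * x s ^ 2) atTop (𝓝 q)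
  eventually_transform : ∀ K κ : ℝ, 0 < κ → ∀ᶠ n : ℕ in atTop,
      empMean (fun s => x s ^ 2) n ≤ K → |empMean (fun s => x s * ε s) n| ≤ κ

namespace AdaptiveRegression

variable {η ν a q v R : ℝ} {x ε β e : ℕ → ℝ}

lemma tendsto_transform (h : AdaptiveRegression η ν a q v R x ε β e) {K : ℝ}
    (hK : ∀ n, empMean (fun s => x s ^ 2) n ≤ K) :
    Tendsto (empMean fun s => x s * ε s) atTop (𝓝 0) := by
  rw [Metric.tendsto_nhds]
  intro κ hκ
  filter_upwards [h.eventually_transform K (κ / 2) (by positivity)] with n hn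
  rw [Real.dist_0_eq_abs]
  linarith [hn (hK n)]

/-- The exploratory samples keep the empirical variance of the rates away from zero. -/
lemma exists_variance_ge (h : AdaptiveRegression η ν a q v R x ε β e) :
    ∃ c : ℝ, 0 < c ∧ ∀ᶠ n in atTop,
      c * (1 + empMean x n ^ 2) ≤ empMean (fun s => x s ^ 2) n - empMean x n ^ 2 := by
  obtain ⟨c, hc, hcq, hcν, hlt⟩ := exists_pos_lt_mul_sub h.q_pos h.ν_pos h.lt
  refine ⟨c, hc, ?_⟩
  have h1 := ((h.tendsto_indicator.sub_const c).mul (h.tendsto_explored_sq.sub_const c)).sub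
    (h.tendsto_explored.pow 2)
  filter_upwards [h1.eventually_const_lt (sub_pos.2 hlt),
    h.tendsto_indicator.eventually_const_lt hcν, eventually_gt_atTop 0] with n hn hν hn0
  set t := empMean x n with ht
  have hvar : empMean (fun s => (x s - t) ^ 2) n = empMean (fun s => x s ^ 2) n - t ^ 2 := by
    have : (fun s => (x s - t) ^ 2) = fun s => (x s ^ 2 - 2 * t * x s) + t ^ 2 := by
      ext s; ring
    rw [this, empMean_add, empMean_sub, empMean_const_mul, empMean_const _ hn0, ← ht]; ring
  have hle : empMean (fun s => β s * (x s - t) ^ 2) n ≤ empMean (fun s => (x s - t) ^ 2) n := by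
    refine empMean_mono fun s => ?_
    rcases h.indicator s with hs | hs <;> rw [hs] <;> nlinarith [sq_nonneg (x s - t)]
  have hexp : empMean (fun s => β s * (x s - t) ^ 2) n = empMean (fun s => β s * x s ^ 2) n
      - 2 * t * empMean (fun s => β s * x s) n + t ^ 2 * empMean β n := by
    have : (fun s => β s * (x s - t) ^ 2)
        = fun s => (β s * x s ^ 2 - 2 * t * (β s * x s)) + t ^ 2 * β s := by ext s; ring
    rw [this, empMean_add, empMean_sub, empMean_const_mul, empMean_const_mul]
  rw [← hvar]
  refine le_trans ?_ hle
  rw [hexp]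
  have hpos : 0 < empMean β n - c := sub_pos.2 hν
  -- Up to the factor `empMean β n - c`, this is a square plus the positive quantity `hn`: the
  -- quadratic in `t` has negative discriminant.
  have hquad : 0 ≤ (empMean β n - c) * ((empMean (fun s => β s * x s ^ 2) n - c)
      - 2 * t * empMean (fun s => β s * x s) n + t ^ 2 * (empMean β n - c)) := by
    nlinarith [sq_nonneg ((empMean β n - c) * t - empMean (fun s => β s * x s) n)]
  have := nonneg_of_mul_nonneg_right hquad hpos
  linarith

/-- The numerator is `A (Z - A E) - (Q - A²) E`, and when the covariance with the noise is at most
half of the slope term, the denominator has size at least `η (Q - A²) / 2`. -/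
lemma centered_eq (h : AdaptiveRegression η ν a q v R x ε β e) {n : ℕ} (hn : 1 ≤ n)
    {c : ℝ} (hc : 0 < c)
    (hvar : c * (1 + empMean x n ^ 2) ≤ empMean (fun s => x s ^ 2) n - empMean x n ^ 2)
    (ht : |empMean (fun s => x s * ε s) n - empMean x n * empMean ε n|
      ≤ η / 2 * (empMean (fun s => x s ^ 2) n - empMean x n ^ 2)) :
    |e n| ≤ (|empMean x n * (empMean (fun s => x s * ε s) n - empMean x n * empMean ε n)|
      / (empMean (fun s => x s ^ 2) n - empMean x n ^ 2) + |empMean ε n|) * (2 / η) := by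
  have hη := h.η_pos
  have hest := h.estimate_eq n hn
  set A := empMean x n
  set Q := empMean (fun s => x s ^ 2) n
  set Z := empMean (fun s => x s * ε s) n
  set E := empMean ε n
  have hd : 0 < Q - A ^ 2 := lt_of_lt_of_le (by positivity) hvar
  have hden : -η * (Q - A ^ 2) + (Z - A * E) ≤ -(η / 2 * (Q - A ^ 2)) := by
    linarith [le_of_abs_le ht]
  have hpos : 0 < η / 2 * (Q - A ^ 2) := by positivity
  rw [hest hd.ne' (by linarith), show A * Z - Q * E = A * (Z - A * E) - (Q - A ^ 2) * E by ring,
    abs_div]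
  have h1 : η / 2 * (Q - A ^ 2) ≤ |-η * (Q - A ^ 2) + (Z - A * E)| := by
    rw [abs_of_neg (by linarith)]; linarith
  calc _ ≤ |A * (Z - A * E) - (Q - A ^ 2) * E| / (η / 2 * (Q - A ^ 2)) := by gcongr
    _ ≤ (|A * (Z - A * E)| + (Q - A ^ 2) * |E|) / (η / 2 * (Q - A ^ 2)) := by
      gcongr
      refine (abs_sub _ _).trans ?_
      rw [abs_mul (Q - A ^ 2), abs_of_pos hd]
    _ = _ := by field_simp

/-- Cauchy–Schwarz for the centered rates. Since `A² ≤ (Q - A²) / c`, the extra factor `A` costs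
only another square root of the variance, so the quotient is bounded at every scale of the rates. -/
lemma abs_mean_mul_centered_le {n : ℕ} (hn : 1 ≤ n) {c V : ℝ} (hc : 0 < c)
    (hvar : c * (1 + empMean x n ^ 2) ≤ empMean (fun s => x s ^ 2) n - empMean x n ^ 2)
    (hV : empMean (fun s => ε s ^ 2) n ≤ V) :
    (empMean (fun s => x s * ε s) n - empMean x n * empMean ε n) ^ 2
      ≤ (empMean (fun s => x s ^ 2) n - empMean x n ^ 2) * V ∧
    |empMean x n * (empMean (fun s => x s * ε s) n - empMean x n * empMean ε n)|
      ≤ √(V / c) * (empMean (fun s => x s ^ 2) n - empMean x n ^ 2) := by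
  set A := empMean x n with hA
  have hvareq : empMean (fun s => (x s - A) ^ 2) n = empMean (fun s => x s ^ 2) n - A ^ 2 := by
    have : (fun s => (x s - A) ^ 2) = fun s => (x s ^ 2 - 2 * A * x s) + A ^ 2 := by
      ext s; ring
    rw [this, empMean_add, empMean_sub, empMean_const_mul, empMean_const _ hn, ← hA]; ring
  have hcov : empMean (fun s => (x s - A) * ε s) n
      = empMean (fun s => x s * ε s) n - A * empMean ε n := by
    have : (fun s => (x s - A) * ε s) = fun s => x s * ε s - A * ε s := by ext s; ring
    rw [this, empMean_sub, empMean_const_mul]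
  have hcs := sq_empMean_mul_le (f := fun s => x s - A) (g := ε) (n := n)
  rw [hcov, hvareq] at hcs
  set D := empMean (fun s => x s ^ 2) n - A ^ 2
  set Z := empMean (fun s => x s * ε s) n - A * empMean ε n
  have hd : 0 < D := lt_of_lt_of_le (by positivity) hvar
  have hZ : Z ^ 2 ≤ D * V := hcs.trans (by gcongr)
  refine ⟨hZ, ?_⟩
  have hV0 : 0 ≤ V := nonneg_of_mul_nonneg_right ((sq_nonneg Z).trans hZ) hd
  have hA2 : A ^ 2 ≤ D / c := by rw [le_div_iff₀ hc]; nlinarith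
  have h2 : (A * Z) ^ 2 ≤ V / c * D ^ 2 := by
    calc (A * Z) ^ 2 = A ^ 2 * Z ^ 2 := by ring
      _ ≤ D / c * (D * V) := by gcongr
      _ = _ := by ring
  calc |A * Z| ≤ √(V / c * D ^ 2) := Real.abs_le_sqrt h2
    _ = _ := by rw [Real.sqrt_mul (by positivity), Real.sqrt_sq hd.le]

/-- The point is a bound without prior control of the rates. If the empirical variance is at least
`K`, Cauchy–Schwarz alone keeps the noise covariance below half of the slope term; if it is below
`K`, then `Q` is bounded and the strong law for transforms applies. -/
lemma eventually_abs_estimate_le (h : AdaptiveRegression η ν a q v R x ε β e) :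
    ∃ M : ℝ, ∀ᶠ n in atTop, |e n| ≤ M := by
  obtain ⟨c, hc, hvar⟩ := h.exists_variance_ge
  have hη := h.η_pos
  have hv : 0 ≤ v := ge_of_tendsto' h.tendsto_noise_sq fun n => by unfold empMean; positivity
  -- Chosen so that `D ≥ K` gives `D (v + 1) ≤ (η D / 2)²`.
  set K := 4 * (v + 1) / η ^ 2 with hK
  have hK0 : 0 < K := by positivity
  set B := √(K / c) with hB
  have hκ : 0 < η * c / 4 := by positivity
  have hN : ∀ᶠ n in atTop, |empMean ε n| < min 1 (η * c / 4 / (B + 1)) := by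
    have := h.tendsto_noise.abs
    rw [abs_zero] at this
    exact this.eventually_lt_const (by positivity)
  refine ⟨(√((v + 1) / c) + 1) * (2 / η), ?_⟩
  filter_upwards [hvar, hN, h.tendsto_noise_sq.eventually_lt_const (lt_add_one v),
    h.eventually_transform (K * (1 + 1 / c)) (η * c / 4) hκ, eventually_ge_atTop 1]
    with n hvar hN hV hZ hn
  obtain ⟨hcs, hAZ⟩ := abs_mean_mul_centered_le hn hc hvar hV.le
  have hd : 0 < empMean (fun s => x s ^ 2) n - empMean x n ^ 2 :=
    lt_of_lt_of_le (by positivity) hvar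
  have hcd : c ≤ empMean (fun s => x s ^ 2) n - empMean x n ^ 2 := by
    nlinarith [sq_nonneg (empMean x n)]
  have hA2 : empMean x n ^ 2 ≤ (empMean (fun s => x s ^ 2) n - empMean x n ^ 2) / c := by
    rw [le_div_iff₀ hc]; nlinarith
  have ht : |empMean (fun s => x s * ε s) n - empMean x n * empMean ε n|
      ≤ η / 2 * (empMean (fun s => x s ^ 2) n - empMean x n ^ 2) := by
    by_cases hcase : K ≤ empMean (fun s => x s ^ 2) n - empMean x n ^ 2
    · refine abs_le_of_sq_le_sq (hcs.trans ?_) (by positivity)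
      have h1 : v + 1 ≤ η ^ 2 / 4 * (empMean (fun s => x s ^ 2) n - empMean x n ^ 2) := by
        calc v + 1 = η ^ 2 / 4 * K := by rw [hK]; field_simp
          _ ≤ _ := by gcongr
      nlinarith
    · rw [not_le] at hcase
      have hZ' := hZ (by
        have : (empMean (fun s => x s ^ 2) n - empMean x n ^ 2) / c ≤ K / c := by gcongr
        rw [mul_add, mul_one, mul_one_div]; linarith)
      -- The remaining budget `η c / 2`, with `c` a lower bound for the variance, is shared equally
      -- between `Z` and `A E`.
      have hA : |empMean x n| ≤ B := by
        refine Real.abs_le_sqrt (hA2.trans ?_)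
        gcongr
      have hAE : |empMean x n * empMean ε n| ≤ η * c / 4 := by
        rw [abs_mul]
        have h2 := hN.le.trans (min_le_right _ _)
        rw [le_div_iff₀ (by positivity)] at h2
        calc |empMean x n| * |empMean ε n| ≤ B * |empMean ε n| := by gcongr
          _ ≤ _ := by nlinarith [abs_nonneg (empMean ε n)]
      calc _ ≤ η * c / 4 + η * c / 4 := (abs_sub _ _).trans (add_le_add hZ' hAE)
        _ = η / 2 * c := by ring
        _ ≤ _ := by gcongr
  refine (h.centered_eq hn hc hvar ht).trans ?_
  gcongr
  · rwa [div_le_iff₀ hd]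
  · exact hN.le.trans (min_le_left _ _)

lemma exists_abs_le (h : AdaptiveRegression η ν a q v R x ε β e) : ∃ B : ℝ, ∀ s, |x s| ≤ B := by
  obtain ⟨M, hM⟩ := h.eventually_abs_estimate_le
  have hev : ∀ᶠ s in atTop, |x s| ≤ max M R := by
    filter_upwards [hM, eventually_ge_atTop 1] with s hs h1
    rcases h.indicator s with hβ | hβ
    · have := h.exploited_eq s h1
      rw [hβ, sub_zero, one_mul, one_mul] at this
      rw [this]; exact hs.trans (le_max_left _ _)
    · have := h.explored_le s
      rw [hβ, one_mul] at this
      exact this.trans (le_max_right _ _)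
  have hb : IsBoundedUnder (· ≤ ·) atTop fun s => |x s| := ⟨max M R, eventually_map.2 hev⟩
  obtain ⟨B, hB⟩ := hb.bddAbove_range
  exact ⟨B, fun s => hB ⟨s, rfl⟩⟩

/-- Bounded rates make the energy condition hold for all `n`, so `Z → 0`; with the variance bounded
below, the quotient tends to zero. -/
lemma tendsto_estimate (h : AdaptiveRegression η ν a q v R x ε β e) :
    Tendsto e atTop (𝓝 0) := by
  obtain ⟨c, hc, hvar⟩ := h.exists_variance_ge
  obtain ⟨B, hB⟩ := h.exists_abs_le
  have hη := h.η_pos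
  have hB0 : 0 ≤ B := (abs_nonneg _).trans (hB 0)
  have hmean : ∀ n, 1 ≤ n → |empMean x n| ≤ B := by
    intro n hn
    rw [abs_le, ← empMean_const B hn, show -empMean (fun _ => B) n = empMean (fun _ => -B) n by
      rw [empMean_const _ hn, empMean_const _ hn]]
    exact ⟨empMean_mono fun s => neg_le_of_abs_le (hB s), empMean_mono fun s => le_of_abs_le (hB s)⟩
  have hsq : ∀ n, empMean (fun s => x s ^ 2) n ≤ B ^ 2 := by
    intro n
    rcases Nat.eq_zero_or_pos n with rfl | hn
    · simp [empMean]; positivity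
    · rw [← empMean_const (B ^ 2) hn]
      exact empMean_mono fun s => sq_le_sq.2 (by rw [abs_of_nonneg hB0]; exact hB s)
  have hZ := h.tendsto_transform hsq
  have hE := h.tendsto_noise
  have hb : Tendsto (fun n => |empMean (fun s => x s * ε s) n| + B * |empMean ε n|) atTop (𝓝 0) := by
    simpa using hZ.abs.add (hE.abs.const_mul B)
  have hbound : Tendsto (fun n => (B * (|empMean (fun s => x s * ε s) n| + B * |empMean ε n|) / c
      + |empMean ε n|) * (2 / η)) atTop (𝓝 0) := by
    simpa using (((hb.const_mul B).div_const c).add hE.abs).mul_const (2 / η)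
  refine squeeze_zero_norm' ?_ hbound
  filter_upwards [hvar, eventually_ge_atTop 1,
    hb.eventually_lt_const (by positivity : 0 < η / 2 * c)] with n hvar hn hsmall
  have hcd : c ≤ empMean (fun s => x s ^ 2) n - empMean x n ^ 2 := by
    nlinarith [sq_nonneg (empMean x n)]
  have hcen : |empMean (fun s => x s * ε s) n - empMean x n * empMean ε n|
      ≤ |empMean (fun s => x s * ε s) n| + B * |empMean ε n| := by
    refine (abs_sub _ _).trans ?_
    rw [abs_mul]
    gcongr
    exact hmean n hn
  rw [Real.norm_eq_abs]
  refine (h.centered_eq hn hc hvar (hcen.trans (hsmall.le.trans (by gcongr)))).trans ?_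
  gcongr
  rw [abs_mul]
  gcongr
  exact hmean n hn

lemma tendsto_unexplored (h : AdaptiveRegression η ν a q v R x ε β e) :
    Tendsto (fun s => x s - β s * x s) atTop (𝓝 0) := by
  refine squeeze_zero_norm' ?_ (by simpa using h.tendsto_estimate.abs)
  filter_upwards [eventually_ge_atTop 1] with s hs
  rw [show x s - β s * x s = (1 - β s) * x s by ring, h.exploited_eq s hs, Real.norm_eq_abs, abs_mul]
  rcases h.indicator s with hβ | hβ <;> simp [hβ]

lemma tendsto_mean (h : AdaptiveRegression η ν a q v R x ε β e) :
    Tendsto (empMean x) atTop (𝓝 a) :=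
  tendsto_empMean_of_sub h.tendsto_explored h.tendsto_unexplored

lemma tendsto_mean_sq (h : AdaptiveRegression η ν a q v R x ε β e) :
    Tendsto (empMean fun s => x s ^ 2) atTop (𝓝 q) := by
  refine tendsto_empMean_of_sub h.tendsto_explored_sq ?_
  -- As `β` is an indicator, `(x - β x)² = x² - β x²`.
  have := h.tendsto_unexplored.pow 2
  rw [zero_pow two_ne_zero] at this
  refine this.congr fun s => ?_
  rcases h.indicator s with hβ | hβ <;> rw [hβ] <;> ring

end AdaptiveRegression

/-- By independence the joint law is a product with an atomless factor, for which the diagonal is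
null. -/
lemma IsGaussianNoise.ae_ne {Ω : Type*} {mΩ : MeasurableSpace Ω} {P : Measure Ω}
    [IsProbabilityMeasure P] {ℱ : Filtration ℕ mΩ} {ε : ℕ → Ω → ℝ} {v : ℝ≥0}
    (hε : IsGaussianNoise P ℱ ε v) (hv : v ≠ 0) (s : ℕ) {F : Ω → ℝ} (hF : Measurable[ℱ s] F) :
    ∀ᵐ ω ∂P, ε s ω ≠ F ω := by
  have hF' : Measurable F := hF.mono (ℱ.le _) le_rfl
  have hind : IndepFun F (ε s) P := by
    rw [IndepFun_iff_Indep]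
    exact indep_of_indep_of_le_left (hε.indep s) hF.comap_le
  have hmap := (indepFun_iff_map_prod_eq_prod_map_map hF'.aemeasurable
    (hε.measurable s).aemeasurable).1 hind
  rw [hε.map_eq] at hmap
  have : IsProbabilityMeasure (P.map F) := Measure.isProbabilityMeasure_map hF'.aemeasurable
  have := nullSingletonClass_gaussianReal (μ := 0) hv
  have hset : MeasurableSet {p : ℝ × ℝ | p.2 = p.1} := measurableSet_eq_fun measurable_snd measurable_fst
  have h0 : ((P.map F).prod (gaussianReal 0 v)) {p : ℝ × ℝ | p.2 = p.1} = 0 := by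
    rw [Measure.measure_prod_null hset]
    refine ae_of_all _ fun x => ?_
    have : Prod.mk x ⁻¹' {p : ℝ × ℝ | p.2 = p.1} = {x} := by ext; simp
    change gaussianReal 0 v (Prod.mk x ⁻¹' _) = 0
    rw [this, measure_singleton]
  rw [← hmap, Measure.map_apply (hF'.prodMk (hε.measurable s)) hset] at h0
  rw [ae_iff]
  simpa using h0

/-! ### The pool as an adaptive linear regression. -/

namespace LendingPool

/-- The information available at the beginning of each slot. -/
def slotFiltration : Filtration ℕ (inferInstance : MeasurableSpace (ℕ → Slot)) where
  seq t := ⨆ i ∈ Set.Iio t, MeasurableSpace.comap (fun ω : ℕ → Slot => ω i) inferInstance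
  mono' _ _ hst := biSup_mono fun _ hi => lt_of_lt_of_le hi hst
  le' _ := iSup₂_le fun i _ => (measurable_pi_apply i).comap_le

lemma measurable_slot {i t : ℕ} (h : i < t) :
    Measurable[slotFiltration t] fun ω : ℕ → Slot => ω i :=
  Measurable.of_comap_le (le_iSup₂_of_le (f := fun i (_ : i ∈ Set.Iio t) =>
    MeasurableSpace.comap (fun ω : ℕ → Slot => ω i) inferInstance) i h le_rfl)

/-- The noise in the borrowers' behaviour. -/
def noise (t : ℕ) (ω : ℕ → Slot) : ℝ := (ω t).2.1

instance (m : Market) (K : Controller) : IsProbabilityMeasure (poolLaw m K) := by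
  unfold poolLaw; infer_instance

lemma measurePreserving_slot (m : Market) (K : Controller) (t : ℕ) :
    MeasurePreserving (fun ω : ℕ → Slot => ω t) (poolLaw m K) (slotLaw m K) :=
  measurePreserving_eval_infinitePi (fun _ => slotLaw m K) t

lemma measurePreserving_slot_noise (m : Market) (K : Controller) :
    MeasurePreserving (fun x : Slot => x.2.1) (slotLaw m K) (gaussianReal 0 (m.ζ ^ 2)) :=
  measurePreserving_fst.comp measurePreserving_snd

lemma measurePreserving_slot_rate (m : Market) (K : Controller) :
    MeasurePreserving (fun x : Slot => x.2.2.2) (slotLaw m K) (explorationLaw K) :=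
  measurePreserving_snd.comp (measurePreserving_snd.comp measurePreserving_snd)

lemma isGaussianNoise (m : Market) (K : Controller) :
    IsGaussianNoise (poolLaw m K) slotFiltration noise (m.ζ ^ 2) where
  measurable_succ s := (measurable_fst.comp measurable_snd).comp (measurable_slot s.lt_succ_self)
  map_eq s := ((measurePreserving_slot_noise m K).comp (measurePreserving_slot m K s)).map_eq
  indep s := by
    have hi : iIndepFun (fun i (ω : ℕ → Slot) => ω i) (poolLaw m K) :=
      iIndepFun_infinitePi (X := fun _ x => x) fun _ => measurable_id
    have h := indep_iSup_of_disjoint (fun i => (measurable_pi_apply i).comap_le) hi.iIndep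
      (S := Set.Iio s) (T := {s}) (by simp)
    refine indep_of_indep_of_le_right h ?_
    rw [iSup_singleton]
    have : Measurable[MeasurableSpace.comap (fun ω : ℕ → Slot => ω s) inferInstance] (noise s) :=
      (measurable_fst.comp measurable_snd).comp (comap_measurable _)
    exact this.comap_le

/-- The rates and the relative changes of the debt, if the latter are computed without the debt. -/
def samples (m : Market) (est : Estimator) (r₀ : ℝ) (ω : ℕ → Slot) : ℕ → (ℕ → ℝ) × (ℕ → ℝ)
  | 0 => (fun _ => r₀, fun _ => 0)
  | t + 1 =>
    let p := samples m est r₀ ω t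
    let growth' := Function.update p.2 t (m.η * (m.equilibriumRate - p.1 t) + noise t ω)
    (Function.update p.1 (t + 1)
      (if (ω t).2.2.1 then (ω t).2.2.2 else est (t + 1) p.1 growth'), growth')

/-- The interest rate of slot `t`. -/
def sampleRate (m : Market) (est : Estimator) (r₀ : ℝ) (ω : ℕ → Slot) (t : ℕ) : ℝ :=
  (samples m est r₀ ω t).1 t

/-- The relative change of the debt in slot `t`. -/
def sampleGrowth (m : Market) (est : Estimator) (r₀ : ℝ) (ω : ℕ → Slot) (t : ℕ) : ℝ :=
  m.η * (m.equilibriumRate - sampleRate m est r₀ ω t) + noise t ω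

section Samples

variable {m : Market} {est : Estimator} {r₀ : ℝ} {ω : ℕ → Slot}

lemma samples_rate_eq {s t : ℕ} (h : s ≤ t) :
    (samples m est r₀ ω t).1 s = sampleRate m est r₀ ω s := by
  induction t, h using Nat.le_induction with
  | base => rfl
  | succ t hst ih => rw [samples]; simp [Function.update_of_ne (by omega : s ≠ t + 1), ih]

lemma samples_growth_eq {s t : ℕ} (h : s < t) :
    (samples m est r₀ ω t).2 s = sampleGrowth m est r₀ ω s := by
  induction t, Nat.succ_le_of_lt h using Nat.le_induction with
  | base => rw [samples]; simp [sampleGrowth, sampleRate]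
  | succ t hst ih => rw [samples]; simp [Function.update_of_ne (by omega : s ≠ t), ih (by omega)]

lemma sampleRate_succ (t : ℕ) : sampleRate m est r₀ ω (t + 1) = if (ω t).2.2.1 then (ω t).2.2.2
    else est (t + 1) (samples m est r₀ ω t).1 (samples m est r₀ ω (t + 1)).2 := by
  rw [sampleRate, samples]; simp

lemma measurable_samples (hest : ∀ n, Measurable fun p : (ℕ → ℝ) × (ℕ → ℝ) => est n p.1 p.2)
    (t : ℕ) : Measurable[slotFiltration t] fun ω => samples m est r₀ ω t := by
  induction t with
  | zero => exact measurable_const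
  | succ t ih =>
    have ih' := ih.mono (slotFiltration.mono t.le_succ) le_rfl
    have hω := measurable_slot t.lt_succ_self
    have hup : ∀ s : ℕ, Measurable fun p : (ℕ → ℝ) × ℝ => Function.update p.1 s p.2 := by
      intro s
      refine measurable_pi_lambda _ fun i => ?_
      by_cases h : i = s
      · subst h; simpa using measurable_snd
      · simp only [Function.update_of_ne h]
        exact (measurable_pi_apply i).comp measurable_fst
    have hr : Measurable[slotFiltration (t + 1)] fun ω => (samples m est r₀ ω t).1 :=
      measurable_fst.comp ih'
    have hrt : Measurable[slotFiltration (t + 1)] fun ω => (samples m est r₀ ω t).1 t :=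
      (measurable_pi_apply t).comp hr
    have hε : Measurable[slotFiltration (t + 1)] (noise t) :=
      (measurable_fst.comp measurable_snd).comp hω
    have hg : Measurable[slotFiltration (t + 1)] fun ω => Function.update (samples m est r₀ ω t).2 t
        (m.η * (m.equilibriumRate - (samples m est r₀ ω t).1 t) + noise t ω) :=
      (hup t).comp ((measurable_snd.comp ih').prodMk
        (((hrt.const_sub _).const_mul _).add hε))
    have hb : Measurable[slotFiltration (t + 1)] fun ω : ℕ → Slot => (ω t).2.2.1 :=
      (measurable_fst.comp (measurable_snd.comp measurable_snd)).comp hω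
    have hw : Measurable[slotFiltration (t + 1)] fun ω : ℕ → Slot => (ω t).2.2.2 :=
      (measurable_snd.comp (measurable_snd.comp measurable_snd)).comp hω
    exact ((hup (t + 1)).comp (hr.prodMk (Measurable.ite (hb (measurableSet_singleton true)) hw
      ((hest (t + 1)).comp (hr.prodMk hg))))).prodMk hg

/-- Predictability of the rates is what makes the limit theorems for transforms apply despite the
feedback from estimates to rates. -/
lemma measurable_sampleRate (hest : ∀ n, Measurable fun p : (ℕ → ℝ) × (ℕ → ℝ) => est n p.1 p.2)
    (t : ℕ) : Measurable[slotFiltration t] fun ω => sampleRate m est r₀ ω t :=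
  (measurable_pi_apply t).comp (measurable_fst.comp (measurable_samples hest t))

/-- The debt cancels from its relative change as long as it is nonzero, and it can vanish only after
a relative change of exactly `-1`, the value excluded by `h`. -/
lemma trajectory_eq_samples {p₀ B₀ : ℝ} (hp : 0 < p₀) (hB : B₀ ≠ 0)
    (h : ∀ t, noise t ω ≠ -1 - m.η * (m.equilibriumRate - sampleRate m est r₀ ω t)) (t : ℕ) :
    0 < (trajectory m est r₀ p₀ B₀ ω t).price ∧ (trajectory m est r₀ p₀ B₀ ω t).debt ≠ 0 ∧
    (trajectory m est r₀ p₀ B₀ ω t).rate = (samples m est r₀ ω t).1 ∧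
    (trajectory m est r₀ p₀ B₀ ω t).growth = (samples m est r₀ ω t).2 := by
  induction t with
  | zero => exact ⟨hp, hB, rfl, rfl⟩
  | succ t ih =>
    obtain ⟨ihp, ihB, ihr, ihg⟩ := ih
    set S := trajectory m est r₀ p₀ B₀ ω t with hS
    have hdebt : nextDebt m S.price S.debt (S.rate t) (ω t).2.1 = S.debt
        + S.debt * (m.η * (m.equilibriumRate - sampleRate m est r₀ ω t) + noise t ω) := by
      rw [nextDebt, m.drift_eq _ _ ihp, ihr]; rfl
    have hgrowth : (nextDebt m S.price S.debt (S.rate t) (ω t).2.1 - S.debt) / S.debt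
        = m.η * (m.equilibriumRate - (samples m est r₀ ω t).1 t) + noise t ω := by
      rw [hdebt, add_sub_cancel_left, mul_div_cancel_left₀ _ ihB]; rfl
    rw [ihr] at hdebt hgrowth
    rw [trajectory, ← hS, samples]
    simp only [step, ihr, ihg, hgrowth, and_self, and_true]
    refine ⟨mul_pos ihp (Real.exp_pos _), ?_⟩
    rw [hdebt, ← mul_one_add]
    refine mul_ne_zero ihB fun h0 => h t ?_
    linarith

end Samples

/-- The estimate from the first `n` samples. -/
def sampleEstimate (m : Market) (est : Estimator) (r₀ : ℝ) (n : ℕ) (ω : ℕ → Slot) : ℝ :=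
  est n (sampleRate m est r₀ ω) (sampleGrowth m est r₀ ω)

/-- The estimator uses only the first `n` samples. -/
def Estimator.IsLocal (est : Estimator) : Prop :=
  ∀ n, 1 ≤ n → ∀ r r' y y' : ℕ → ℝ, (∀ s < n, r s = r' s) → (∀ s < n, y s = y' s) →
    est n r y = est n r' y'

lemma sampleRate_succ_of_isLocal {m : Market} {est : Estimator} (hloc : est.IsLocal) (r₀ : ℝ)
    (ω : ℕ → Slot) (t : ℕ) : sampleRate m est r₀ ω (t + 1) =
      if (ω t).2.2.1 then (ω t).2.2.2 else sampleEstimate m est r₀ (t + 1) ω := by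
  rw [sampleRate_succ, sampleEstimate]
  congr 1
  exact hloc _ (Nat.le_add_left 1 t) _ _ _ _
    (fun s hs => samples_rate_eq (Nat.lt_succ_iff.1 hs)) fun s hs => samples_growth_eq hs

/-- The single fatal noise value of each slot is determined by the past, so it is almost surely
never taken. Locality is needed because the stored sequences agree with the samples only on the
slots already observed. -/
lemma stoppedRate_ae_eq {m : Market} (K : Controller) {est : Estimator} (hloc : est.IsLocal)
    (hest : ∀ n, Measurable fun p : (ℕ → ℝ) × (ℕ → ℝ) => est n p.1 p.2) (r₀ : ℝ) {p₀ B₀ : ℝ}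
    (hp : 0 < p₀) (hB : 0 < B₀) :
    ∀ᵐ ω ∂(poolLaw m K), ∀ τ, 1 ≤ τ →
      stoppedRate m est r₀ p₀ B₀ τ ω = sampleEstimate m est r₀ τ ω := by
  have hne : ∀ᵐ ω ∂(poolLaw m K), ∀ t,
      noise t ω ≠ -1 - m.η * (m.equilibriumRate - sampleRate m est r₀ ω t) :=
    ae_all_iff.2 fun t => (isGaussianNoise m K).ae_ne (pow_pos m.ζ_pos 2).ne' t
      ((((measurable_sampleRate hest t).const_sub _).const_mul _).const_sub _)
  filter_upwards [hne] with ω hω τ hτ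
  obtain ⟨-, -, hr, hg⟩ := trajectory_eq_samples hp hB.ne' hω τ
  rw [stoppedRate, hr, hg]
  exact hloc τ hτ _ _ _ _ (fun s hs => samples_rate_eq hs.le) fun s hs => samples_growth_eq hs

lemma knownElasticityEstimator_isLocal (η : ℝ) : (knownElasticityEstimator η).IsLocal := by
  intro n _ r r' y y' hr hy
  unfold knownElasticityEstimator
  congr 2
  exact Finset.sum_congr rfl fun s hs => by
    rw [hr s (Finset.mem_range.1 hs), hy s (Finset.mem_range.1 hs)]

/-- With known elasticity, the error of the estimate is the mean noise, scaled by `1 / η`. -/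
theorem knownElasticity_unbiased (m : Market) (hη : 0 < m.η) (K : Controller) (r₀ : ℝ) {p₀ B₀ : ℝ}
    (hp : 0 < p₀) (hB : 0 < B₀) {τ : ℕ} (hτ : 1 ≤ τ) :
    Integrable (stoppedRate m (knownElasticityEstimator m.η) r₀ p₀ B₀ τ) (poolLaw m K) ∧
    ∫ ω, stoppedRate m (knownElasticityEstimator m.η) r₀ p₀ B₀ τ ω ∂(poolLaw m K)
      = m.equilibriumRate := by
  have hnoise := isGaussianNoise m K
  have hest : ∀ n, Measurable fun p : (ℕ → ℝ) × (ℕ → ℝ) =>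
      knownElasticityEstimator m.η n p.1 p.2 := by
    intro n; unfold knownElasticityEstimator; fun_prop
  have hτ' : (τ : ℝ) ≠ 0 := by positivity
  have heq : stoppedRate m (knownElasticityEstimator m.η) r₀ p₀ B₀ τ =ᵐ[poolLaw m K]
      fun ω => m.equilibriumRate + (∑ s ∈ Finset.range τ, noise s ω) / τ / m.η := by
    filter_upwards [stoppedRate_ae_eq K (knownElasticityEstimator_isLocal m.η) hest r₀ hp hB]
      with ω hω
    rw [hω τ hτ, sampleEstimate, knownElasticityEstimator]
    -- The adaptively chosen rate cancels, so no property of the exploration is used.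
    have : ∀ s, sampleGrowth m (knownElasticityEstimator m.η) r₀ ω s
        + m.η * sampleRate m (knownElasticityEstimator m.η) r₀ ω s
        = m.η * m.equilibriumRate + noise s ω := by
      intro s; rw [sampleGrowth]; ring
    simp_rw [this]
    rw [Finset.sum_add_distrib, Finset.sum_const, Finset.card_range, nsmul_eq_mul]
    field_simp
  have hmp : ∀ s, MeasurePreserving (noise s) (poolLaw m K) (gaussianReal 0 (m.ζ ^ 2)) :=
    fun s => ⟨hnoise.measurable s, hnoise.map_eq s⟩
  have hi : ∀ s, Integrable (noise s) (poolLaw m K) := fun s =>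
    (hmp s).integrable_comp_of_integrable
      ((memLp_id_gaussianReal 1).integrable (by norm_num))
  have hz : ∀ s, ∫ ω, noise s ω ∂(poolLaw m K) = 0 := by
    intro s
    have := integral_map (μ := poolLaw m K) (hmp s).measurable.aemeasurable (f := fun x : ℝ => x)
      aestronglyMeasurable_id
    rw [(hmp s).map_eq, integral_id_gaussianReal] at this
    exact this.symm
  have hsum : Integrable (fun ω => (∑ s ∈ Finset.range τ, noise s ω) / τ / m.η) (poolLaw m K) :=
    ((integrable_finsetSum _ fun s _ => hi s).div_const _).div_const _
  refine ⟨((integrable_const _).add hsum).congr heq.symm, ?_⟩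
  rw [integral_congr_ae heq, integral_add (integrable_const _) hsum, integral_div, integral_div,
    integral_finsetSum _ fun s _ => hi s]
  simp [hz]

end LendingPool

/-! ### Closed form of least squares. -/

namespace LendingPool

section LeastSquares

variable (n : ℕ) (r y : ℕ → ℝ)

lemma designMatrix_gram : (designMatrix n r).transpose * designMatrix n r =
    !![(n : ℝ), ∑ s ∈ Finset.range n, r s;
      ∑ s ∈ Finset.range n, r s, ∑ s ∈ Finset.range n, r s ^ 2] := by
  rw [Finset.sum_range, Finset.sum_range]
  ext i j
  fin_cases i <;> fin_cases j <;> simp [designMatrix, Matrix.mul_apply, sq]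

lemma designMatrix_transpose_mulVec :
    (designMatrix n r).transpose.mulVec (fun i : Fin n => y i) =
      ![∑ s ∈ Finset.range n, y s, ∑ s ∈ Finset.range n, r s * y s] := by
  rw [Finset.sum_range, Finset.sum_range]
  ext i
  fin_cases i <;> simp [designMatrix, Matrix.mulVec, dotProduct]

/-- Determinant of the normal equations. -/
def lsDet : ℝ :=
  n * ∑ s ∈ Finset.range n, r s ^ 2 - (∑ s ∈ Finset.range n, r s) ^ 2

/-- Numerator of the slope. -/
def lsSlope : ℝ :=
  n * ∑ s ∈ Finset.range n, r s * y s - (∑ s ∈ Finset.range n, r s) * ∑ s ∈ Finset.range n, y s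

/-- Numerator of the intercept, negated. -/
def lsIntercept : ℝ :=
  (∑ s ∈ Finset.range n, r s) * (∑ s ∈ Finset.range n, r s * y s)
    - (∑ s ∈ Finset.range n, r s ^ 2) * ∑ s ∈ Finset.range n, y s

/-- Cramer's rule for the normal equations; it needs no nonsingularity, since both the matrix
inverse and division return zero when the determinant vanishes. -/
lemma lsCoeff_eq :
    lsCoeff n r y = ![-(lsIntercept n r y / lsDet n r), lsSlope n r y / lsDet n r] := by
  rw [lsCoeff, designMatrix_gram, designMatrix_transpose_mulVec, Matrix.inv_def,
    Matrix.adjugate_fin_two_of, Matrix.det_fin_two_of, Ring.inverse_eq_inv']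
  ext i
  fin_cases i <;> simp [lsIntercept, lsDet, lsSlope, Matrix.mulVec, dotProduct] <;> ring

lemma lsEstimator_eq : lsEstimator n r y =
    if lsDet n r ≠ 0 ∧ lsSlope n r y ≠ 0 then lsIntercept n r y / lsSlope n r y else r (n - 1) := by
  have hdet : ((designMatrix n r).transpose * designMatrix n r).det = lsDet n r := by
    rw [designMatrix_gram, Matrix.det_fin_two_of, lsDet, sq]
  rw [lsEstimator, hdet, lsCoeff_eq]
  by_cases h : lsDet n r = 0
  · simp [h]
  by_cases h' : lsSlope n r y = 0
  · simp [h']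
  · rw [if_pos ⟨isUnit_iff_ne_zero.2 h, by simp [h, h']⟩, if_pos ⟨h, h'⟩]
    simp only [Matrix.cons_val_zero, Matrix.cons_val_one, neg_neg]
    field_simp

lemma measurable_lsEstimator :
    Measurable fun p : (ℕ → ℝ) × (ℕ → ℝ) => lsEstimator n p.1 p.2 := by
  simp_rw [lsEstimator_eq]
  have h1 : Measurable fun p : (ℕ → ℝ) × (ℕ → ℝ) => lsDet n p.1 := by unfold lsDet; fun_prop
  have h2 : Measurable fun p : (ℕ → ℝ) × (ℕ → ℝ) => lsSlope n p.1 p.2 := by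
    unfold lsSlope; fun_prop
  have h3 : Measurable fun p : (ℕ → ℝ) × (ℕ → ℝ) => lsIntercept n p.1 p.2 := by
    unfold lsIntercept; fun_prop
  exact Measurable.ite ((h1 (measurableSet_singleton 0)).compl.inter
    (h2 (measurableSet_singleton 0)).compl) (h3.div h2)
    ((measurable_pi_apply (n - 1)).comp measurable_fst)

lemma lsEstimator_isLocal : lsEstimator.IsLocal := by
  intro n hn r r' y y' hr hy
  have hs1 : ∑ s ∈ Finset.range n, r s = ∑ s ∈ Finset.range n, r' s :=
    Finset.sum_congr rfl fun s hs => hr s (Finset.mem_range.1 hs)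
  have hs2 : ∑ s ∈ Finset.range n, r s ^ 2 = ∑ s ∈ Finset.range n, r' s ^ 2 :=
    Finset.sum_congr rfl fun s hs => by rw [hr s (Finset.mem_range.1 hs)]
  have hs3 : ∑ s ∈ Finset.range n, y s = ∑ s ∈ Finset.range n, y' s :=
    Finset.sum_congr rfl fun s hs => hy s (Finset.mem_range.1 hs)
  have hs4 : ∑ s ∈ Finset.range n, r s * y s = ∑ s ∈ Finset.range n, r' s * y' s :=
    Finset.sum_congr rfl fun s hs => by
      rw [hr s (Finset.mem_range.1 hs), hy s (Finset.mem_range.1 hs)]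
  have hD : lsDet n r = lsDet n r' := by rw [lsDet, lsDet, hs1, hs2]
  have hS : lsSlope n r y = lsSlope n r' y' := by rw [lsSlope, lsSlope, hs1, hs3, hs4]
  have hI : lsIntercept n r y = lsIntercept n r' y' := by
    rw [lsIntercept, lsIntercept, hs1, hs2, hs3, hs4]
  -- The fallback rate `r (n - 1)` is among the first `n` samples only for `n ≥ 1`.
  rw [lsEstimator_eq, lsEstimator_eq, hD, hS, hI, hr (n - 1) (by omega)]

end LeastSquares

/-- The error of the least-squares estimate in a linear model, in terms of empirical means of the
centered rates and of the noise. -/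
lemma lsEstimator_sub_eq {η ρ : ℝ} {r y x ε : ℕ → ℝ} (hx : ∀ s, r s = x s + ρ)
    (hy : ∀ s, y s = η * (ρ - r s) + ε s) {n : ℕ} (hn : 1 ≤ n)
    (hdet : empMean (fun s => x s ^ 2) n - empMean x n ^ 2 ≠ 0)
    (hslope : -η * (empMean (fun s => x s ^ 2) n - empMean x n ^ 2)
      + (empMean (fun s => x s * ε s) n - empMean x n * empMean ε n) ≠ 0) :
    lsEstimator n r y - ρ = (empMean x n * empMean (fun s => x s * ε s) n
        - empMean (fun s => x s ^ 2) n * empMean ε n) /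
      (-η * (empMean (fun s => x s ^ 2) n - empMean x n ^ 2)
        + (empMean (fun s => x s * ε s) n - empMean x n * empMean ε n)) := by
  have hn' : (n : ℝ) ≠ 0 := by positivity
  have hsum : ∀ f : ℕ → ℝ, ∑ s ∈ Finset.range n, f s = n * empMean f n := by
    intro f; rw [empMean]; field_simp
  have e1 : empMean r n = empMean x n + ρ := by
    rw [funext hx, empMean_add, empMean_const ρ hn]
  have e2 : empMean (fun s => r s ^ 2) n
      = empMean (fun s => x s ^ 2) n + 2 * ρ * empMean x n + ρ ^ 2 := by
    rw [← empMean_const (ρ ^ 2) hn, ← empMean_const_mul, ← empMean_add, ← empMean_add]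
    congr 1; ext s; rw [hx]; ring
  have e3 : empMean y n = -η * empMean x n + empMean ε n := by
    rw [← empMean_const_mul, ← empMean_add]
    congr 1; ext s; rw [hy, hx]; ring
  have e4 : empMean (fun s => r s * y s) n = -η * empMean (fun s => x s ^ 2) n
      + empMean (fun s => x s * ε s) n + ρ * (-η * empMean x n + empMean ε n) := by
    rw [← e3, ← empMean_const_mul, ← empMean_const_mul, ← empMean_add, ← empMean_add]
    congr 1; ext s; rw [hy, hx]; ring
  have hD : lsDet n r = n ^ 2 * (empMean (fun s => x s ^ 2) n - empMean x n ^ 2) := by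
    rw [lsDet, hsum, hsum, e1, e2]; ring
  have hS : lsSlope n r y = n ^ 2 * (-η * (empMean (fun s => x s ^ 2) n - empMean x n ^ 2)
      + (empMean (fun s => x s * ε s) n - empMean x n * empMean ε n)) := by
    rw [lsSlope, hsum, hsum, hsum, e1, e3, e4]; ring
  -- Splitting off `ρ` times the slope isolates the error of the quotient.
  have hI : lsIntercept n r y = n ^ 2 * (empMean x n * empMean (fun s => x s * ε s) n
        - empMean (fun s => x s ^ 2) n * empMean ε n) + ρ * lsSlope n r y := by
    rw [hS, lsIntercept, hsum, hsum, hsum, hsum, e1, e2, e3, e4]; ring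
  have hS0 : lsSlope n r y ≠ 0 := by
    rw [hS]; exact mul_ne_zero (pow_ne_zero 2 hn') hslope
  rw [lsEstimator_eq, if_pos ⟨by rw [hD]; exact mul_ne_zero (pow_ne_zero 2 hn') hdet, hS0⟩, hI,
    add_div, mul_div_cancel_right₀ _ hS0, add_sub_cancel_right, hS,
    mul_div_mul_left _ _ (pow_ne_zero 2 hn')]

/-! ### Exploration moments and typical trajectories. -/

lemma ae_tendsto_empMean_slot (m : Market) (K : Controller) {f : Slot → ℝ} (hf : Measurable f)
    (hi : Integrable f (slotLaw m K)) :
    ∀ᵐ ω ∂(poolLaw m K),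
      Tendsto (empMean fun s => f (ω s)) atTop (𝓝 (∫ x, f x ∂(slotLaw m K))) := by
  have hmp := measurePreserving_slot m K
  have hindep : iIndepFun (fun i (ω : ℕ → Slot) => f (ω i)) (poolLaw m K) :=
    iIndepFun_infinitePi (X := fun _ => f) fun _ => hf
  have hident : ∀ i, IdentDistrib (fun ω : ℕ → Slot => f (ω i)) (fun ω => f (ω 0))
      (poolLaw m K) (poolLaw m K) := by
    intro i
    have h : IdentDistrib (fun ω : ℕ → Slot => ω i) (fun ω => ω 0) (poolLaw m K) (poolLaw m K) :=
      ⟨(hmp i).measurable.aemeasurable, (hmp 0).measurable.aemeasurable,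
        (hmp i).map_eq.trans (hmp 0).map_eq.symm⟩
    exact h.comp hf
  have h := strong_law_ae_real (fun i (ω : ℕ → Slot) => f (ω i))
    ((hmp 0).integrable_comp_of_integrable hi) (fun i j hij => hindep.indepFun hij) hident
  have hint : ∫ ω, f (ω 0) ∂(poolLaw m K) = ∫ x, f x ∂(slotLaw m K) := by
    rw [← (hmp 0).map_eq, integral_map (hmp 0).measurable.aemeasurable hf.aestronglyMeasurable]
  rw [hint] at h
  exact h

/-- Indicator of exploration. -/
def explores (x : Slot) : ℝ := if x.2.2.1 then 1 else 0

lemma measurable_explores : Measurable explores :=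
  Measurable.ite ((measurable_fst.comp (measurable_snd.comp measurable_snd))
    (measurableSet_singleton true)) measurable_const measurable_const

lemma explores_eq (x : Slot) : explores x = 0 ∨ explores x = 1 := by
  unfold explores; split_ifs <;> simp

/-- Distance of the equilibrium rate from the farthest exploratory rate. -/
def explorationRadius (m : Market) (K : Controller) : ℝ :=
  max |K.rMin - m.equilibriumRate| |K.rMax - m.equilibriumRate|

lemma ae_abs_explored_le (m : Market) (K : Controller) : ∀ᵐ x ∂(slotLaw m K),
    |explores x * (x.2.2.2 - m.equilibriumRate)| ≤ explorationRadius m K := by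
  have h : ∀ᵐ w ∂(explorationLaw K), w ∈ Set.Icc K.rMin K.rMax :=
    ae_cond_mem measurableSet_Icc
  have h' := (measurePreserving_slot_rate m K).quasiMeasurePreserving.ae h
  filter_upwards [h'] with x hx
  have hle : |x.2.2.2 - m.equilibriumRate| ≤ explorationRadius m K :=
    abs_le_max_abs_abs (sub_le_sub_right hx.1 _) (sub_le_sub_right hx.2 _)
  rcases explores_eq x with h0 | h0 <;> rw [h0]
  · simpa using (abs_nonneg _).trans hle
  · simpa using hle

lemma measurable_explored (ρ : ℝ) : Measurable fun x : Slot => explores x * (x.2.2.2 - ρ) :=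
  measurable_explores.mul
    ((measurable_snd.comp (measurable_snd.comp measurable_snd)).sub_const ρ)

lemma integrable_explores (m : Market) (K : Controller) : Integrable explores (slotLaw m K) :=
  Integrable.of_bound measurable_explores.aestronglyMeasurable 1 (ae_of_all _ fun x => by
    rcases explores_eq x with h | h <;> simp [h])

lemma integrable_explored (m : Market) (K : Controller) :
    Integrable (fun x => explores x * (x.2.2.2 - m.equilibriumRate)) (slotLaw m K) :=
  Integrable.of_bound (measurable_explored _).aestronglyMeasurable _ (ae_abs_explored_le m K)

lemma measurable_explored_sq (ρ : ℝ) : Measurable fun x : Slot => explores x * (x.2.2.2 - ρ) ^ 2 :=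
  measurable_explores.mul
    (((measurable_snd.comp (measurable_snd.comp measurable_snd)).sub_const ρ).pow_const 2)

lemma integrable_explored_sq (m : Market) (K : Controller) :
    Integrable (fun x => explores x * (x.2.2.2 - m.equilibriumRate) ^ 2) (slotLaw m K) := by
  refine Integrable.of_bound (measurable_explored_sq _).aestronglyMeasurable
    (explorationRadius m K ^ 2) ?_
  filter_upwards [ae_abs_explored_le m K] with x hx
  have : explores x * (x.2.2.2 - m.equilibriumRate) ^ 2
      = (explores x * (x.2.2.2 - m.equilibriumRate)) ^ 2 := by
    rcases explores_eq x with h | h <;> rw [h] <;> ring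
  rw [this, norm_pow]
  exact pow_le_pow_left₀ (norm_nonneg _) hx 2

/-- Probability of exploration in a slot. -/
def exploreProb (m : Market) (K : Controller) : ℝ := ∫ x, explores x ∂(slotLaw m K)

/-- Mean error of the exploratory rates, with exploited rates counted as exact. -/
def exploreMean (m : Market) (K : Controller) : ℝ :=
  ∫ x, explores x * (x.2.2.2 - m.equilibriumRate) ∂(slotLaw m K)

/-- Mean squared error of the exploratory rates, with exploited rates counted as exact. -/
def exploreMeanSq (m : Market) (K : Controller) : ℝ :=
  ∫ x, explores x * (x.2.2.2 - m.equilibriumRate) ^ 2 ∂(slotLaw m K)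

/-- The uniform law has no atoms, so the exploratory rate is not degenerate; this is the source of
identifiability. -/
lemma slotLaw_explores_pos (m : Market) (K : Controller) (k : ℝ) :
    0 < slotLaw m K {x | explores x = 1 ∧ x.2.2.2 ≠ k} := by
  have hset : {x : Slot | explores x = 1 ∧ x.2.2.2 ≠ k}
      = Set.univ ×ˢ (Set.univ ×ˢ ({true} ×ˢ {k}ᶜ)) := by
    ext x; simp [explores]
  have hk : explorationLaw K {k}ᶜ = 1 := by
    rw [prob_compl_eq_one_iff (measurableSet_singleton k)]
    exact cond_absolutelyContinuous (measure_singleton k)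
  have hb : 0 < bernoulliMeasure true false K.ν {true} := by
    rw [bernoulliMeasure_apply_of_mem_of_notMem _ (measurableSet_singleton _) (by simp) (by simp)]
    exact ENNReal.coe_pos.2 (NNReal.coe_pos.1 (show (0 : ℝ) < (K.ν : ℝ) from K.ν_pos))
  rw [hset, slotLaw, Measure.prod_prod, Measure.prod_prod, Measure.prod_prod, hk]
  simpa using hb

lemma exploreProb_pos (m : Market) (K : Controller) : 0 < exploreProb m K := by
  rw [exploreProb, integral_pos_iff_support_of_nonneg _ (integrable_explores m K)]
  · refine (slotLaw_explores_pos m K 0).trans_le (measure_mono fun x hx => ?_)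
    rw [Function.mem_support, hx.1]; exact one_ne_zero
  · intro x; rcases explores_eq x with h | h <;> simp [h]

/-- Strict Cauchy–Schwarz: with `t` the mean error given exploration, `β (x - t)²` is positive with
positive probability. -/
lemma exploreMean_sq_lt (m : Market) (K : Controller) :
    exploreMean m K ^ 2 < exploreProb m K * exploreMeanSq m K := by
  have hν := exploreProb_pos m K
  set t := exploreMean m K / exploreProb m K with ht
  have hexp : ∀ x : Slot, explores x * (x.2.2.2 - m.equilibriumRate - t) ^ 2 =
      explores x * (x.2.2.2 - m.equilibriumRate) ^ 2
      - 2 * t * (explores x * (x.2.2.2 - m.equilibriumRate)) + t ^ 2 * explores x := by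
    intro x; ring
  have hi1 := integrable_explored_sq m K
  have hi2 := (integrable_explored m K).const_mul (2 * t)
  have hi3 := (integrable_explores m K).const_mul (t ^ 2)
  have hi : Integrable (fun x : Slot => explores x * (x.2.2.2 - m.equilibriumRate - t) ^ 2)
      (slotLaw m K) := by
    simp_rw [hexp]; exact (hi1.sub hi2).add hi3
  have hval : ∫ x, explores x * (x.2.2.2 - m.equilibriumRate - t) ^ 2 ∂(slotLaw m K)
      = exploreMeanSq m K - 2 * t * exploreMean m K + t ^ 2 * exploreProb m K := by
    have h := integral_add (hi1.sub hi2) hi3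
    simp only [Pi.sub_apply] at h
    simp_rw [hexp]
    rw [h, integral_sub hi1 hi2, integral_const_mul, integral_const_mul]
    rfl
  have hpos : 0 < ∫ x, explores x * (x.2.2.2 - m.equilibriumRate - t) ^ 2 ∂(slotLaw m K) := by
    rw [integral_pos_iff_support_of_nonneg _ hi]
    · refine (slotLaw_explores_pos m K (m.equilibriumRate + t)).trans_le
        (measure_mono fun x hx => ?_)
      rw [Function.mem_support, hx.1, one_mul]
      refine pow_ne_zero 2 fun h0 => hx.2 ?_
      linarith
    · intro x
      rcases explores_eq x with h | h <;> simp only [h, Pi.zero_apply] <;> positivity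
  rw [hval] at hpos
  have hm : exploreMean m K = t * exploreProb m K := by rw [ht]; field_simp
  rw [hm] at hpos ⊢
  nlinarith

lemma exploreMeanSq_pos (m : Market) (K : Controller) : 0 < exploreMeanSq m K :=
  pos_of_mul_pos_right ((sq_nonneg _).trans_lt (exploreMean_sq_lt m K)) (exploreProb_pos m K).le

lemma exploreProb_le_one (m : Market) (K : Controller) : exploreProb m K ≤ 1 := by
  calc exploreProb m K ≤ ∫ _, (1 : ℝ) ∂(slotLaw m K) :=
        integral_mono (integrable_explores m K) (integrable_const _) fun x => by
          rcases explores_eq x with h | h <;> simp [h]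
    _ = 1 := by simp

lemma exploreMean_sq_lt_exploreMeanSq (m : Market) (K : Controller) :
    exploreMean m K ^ 2 < exploreMeanSq m K :=
  (exploreMean_sq_lt m K).trans_le
    (mul_le_of_le_one_left (exploreMeanSq_pos m K).le (exploreProb_le_one m K))

/-- Error of the interest rate of a slot under the least-squares controller. -/
def rateError (m : Market) (r₀ : ℝ) (s : ℕ) (ω : ℕ → Slot) : ℝ :=
  sampleRate m lsEstimator r₀ ω s - m.equilibriumRate

/-- Error of the least-squares estimate. -/
def estimateError (m : Market) (r₀ : ℝ) (n : ℕ) (ω : ℕ → Slot) : ℝ :=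
  sampleEstimate m lsEstimator r₀ n ω - m.equilibriumRate

/-- Indicator that the rate of slot `s` is exploratory. -/
def explored (ω : ℕ → Slot) : ℕ → ℝ
  | 0 => 0
  | s + 1 => explores (ω s)

lemma measurable_rateError (m : Market) (r₀ : ℝ) (s : ℕ) :
    Measurable[slotFiltration s] (rateError m r₀ s) :=
  (measurable_sampleRate measurable_lsEstimator s).sub_const _

lemma measurable_estimateError (m : Market) (r₀ : ℝ) (n : ℕ) :
    Measurable (estimateError m r₀ n) := by
  have hr : ∀ s, Measurable fun ω => sampleRate m lsEstimator r₀ ω s := fun s =>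
    (measurable_sampleRate measurable_lsEstimator s).mono (slotFiltration.le s) le_rfl
  have hε : ∀ s, Measurable (noise s) := fun s =>
    (measurable_fst.comp measurable_snd).comp (measurable_pi_apply s)
  exact ((measurable_lsEstimator n).comp ((measurable_pi_lambda _ hr).prodMk
    (measurable_pi_lambda _ fun s => (((hr s).const_sub _).const_mul _).add (hε s)))).sub_const _

lemma explored_mul_rateError (m : Market) (r₀ : ℝ) (ω : ℕ → Slot) (s : ℕ) :
    explored ω (s + 1) * rateError m r₀ (s + 1) ω
      = explores (ω s) * ((ω s).2.2.2 - m.equilibriumRate) := by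
  rw [rateError, sampleRate_succ_of_isLocal lsEstimator_isLocal]
  simp only [explored, explores]
  split_ifs <;> simp

/-- Almost every trajectory of the least-squares controller is typical. -/
theorem ae_adaptiveRegression (m : Market) (hη : 0 < m.η) (K : Controller) (r₀ : ℝ) :
    ∀ᵐ ω ∂(poolLaw m K), AdaptiveRegression m.η (exploreProb m K) (exploreMean m K)
      (exploreMeanSq m K) (∫ x : ℝ, x ^ 2 ∂(gaussianReal 0 (m.ζ ^ 2))) (explorationRadius m K)
      (fun s => rateError m r₀ s ω) (fun s => noise s ω) (explored ω)
      (fun n => estimateError m r₀ n ω) := by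
  have hv : m.ζ ^ 2 ≠ 0 := (pow_pos m.ζ_pos 2).ne'
  have hnoise := isGaussianNoise m K
  have hmp := measurePreserving_slot_noise m K
  have hle : ∀ᵐ ω ∂(poolLaw m K), ∀ s,
      |explores (ω s) * ((ω s).2.2.2 - m.equilibriumRate)| ≤ explorationRadius m K :=
    ae_all_iff.2 fun s => (measurePreserving_slot m K s).quasiMeasurePreserving.ae
      (ae_abs_explored_le m K)
  have hi1 : Integrable (fun x : ℝ => x) (gaussianReal 0 (m.ζ ^ 2)) :=
    (memLp_id_gaussianReal 1).integrable (by norm_num)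
  have hi2 : Integrable (fun x : ℝ => x ^ 2) (gaussianReal 0 (m.ζ ^ 2)) :=
    (memLp_id_gaussianReal 2).integrable_sq
  have hz : ∫ x : Slot, x.2.1 ∂(slotLaw m K) = 0 := by
    have := integral_map (μ := slotLaw m K) hmp.measurable.aemeasurable (f := fun x : ℝ => x)
      aestronglyMeasurable_id
    rw [hmp.map_eq, integral_id_gaussianReal] at this
    exact this.symm
  have hz2 : ∫ x : Slot, x.2.1 ^ 2 ∂(slotLaw m K) = ∫ x : ℝ, x ^ 2 ∂(gaussianReal 0 (m.ζ ^ 2)) := by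
    rw [← hmp.map_eq, integral_map hmp.measurable.aemeasurable (by fun_prop)]
  have hs1 := ae_tendsto_empMean_slot m K (f := fun x => x.2.1) hmp.measurable
    (hmp.integrable_comp_of_integrable hi1)
  have hs2 := ae_tendsto_empMean_slot m K (f := fun x => x.2.1 ^ 2) (hmp.measurable.pow_const 2)
    (hmp.integrable_comp_of_integrable hi2)
  rw [hz] at hs1
  rw [hz2] at hs2
  filter_upwards [hle, hs1, hs2,
    ae_tendsto_empMean_slot m K measurable_explores (integrable_explores m K),
    ae_tendsto_empMean_slot m K (measurable_explored m.equilibriumRate) (integrable_explored m K),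
    ae_tendsto_empMean_slot m K (measurable_explored_sq m.equilibriumRate)
      (integrable_explored_sq m K),
    hnoise.ae_eventually_abs_sum_le hv (measurable_rateError m r₀)]
    with ω hle hs1 hs2 hs3 hs4 hs5 htr
  refine ⟨hη, exploreProb_pos m K, exploreMeanSq_pos m K, exploreMean_sq_lt m K, ?_, ?_, ?_, ?_,
    hs1, hs2, tendsto_empMean_shift hs3 rfl fun s => rfl,
    tendsto_empMean_shift hs4 (by simp [explored]) (explored_mul_rateError m r₀ ω),
    tendsto_empMean_shift hs5 (by simp [explored]) fun s => ?_, ?_⟩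
  · rintro (_ | s)
    · exact Or.inl rfl
    · exact explores_eq _
  · rintro (_ | s)
    · simpa [explored] using (abs_nonneg _).trans (hle 0)
    · rw [explored_mul_rateError]; exact hle s
  -- The arbitrary initial rate counts as unexplored but is no estimate, so slot `0` is excluded.
  · rintro (_ | s) h
    · omega
    · simp only [rateError, estimateError]
      rw [sampleRate_succ_of_isLocal lsEstimator_isLocal]
      simp only [explored, explores]
      split_ifs <;> simp
  · intro n hn hdet hslope
    exact lsEstimator_sub_eq (fun s => (sub_add_cancel _ _).symm) (fun s => rfl) hn hdet hslope
  · have h := explored_mul_rateError m r₀ ω s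
    simp only [explored] at h ⊢
    rcases explores_eq (ω s) with h0 | h0 <;> rw [h0] at h ⊢
    · simp
    · rw [one_mul, one_mul] at h
      rw [h]
  · intro Q κ hκ
    filter_upwards [htr Q κ hκ, eventually_gt_atTop 0] with n hn hn0 hQ
    have hn' : (0 : ℝ) < n := by exact_mod_cast hn0
    rw [empMean, div_le_iff₀ hn'] at hQ
    rw [empMean, abs_div, Nat.abs_cast, div_le_iff₀ hn']
    exact hn hQ

end LendingPool

/-! ### Gaussian mass against exponential mass. -/

/-- Around its mean, a centered Gaussian law has more mass than an exponential law of suitable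
scale. -/
lemma one_sub_exp_lt_gaussianReal (v : ℝ≥0) (hv : v ≠ 0) {L : ℝ} (hL : 0 < L) :
    1 - Real.exp (-L) < (gaussianReal 0 v).real {x | |x| < 10 * √v * L} := by
  have hv' : 0 < (v : ℝ) := by positivity
  have hsv : 0 < √(v : ℝ) := Real.sqrt_pos.2 hv'
  have hsq : √(v : ℝ) ^ 2 = v := Real.sq_sqrt hv'.le
  set t := 10 * √(v : ℝ) * L with ht
  have ht0 : 0 < t := by positivity
  rcases le_or_gt L (1 / 5) with hle | hgt
  -- For `L ≤ 1/5` one has `t ≤ 2√v`, so the density is at least `e⁻² / √(2πv)` on an interval of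
  -- length `20 √v L`. Since `√(2π) e² ≤ 20`, the mass is at least `L > 1 - exp (-L)`.
  · have hset : {x : ℝ | |x| < t} = Set.Ioo (-t) t := by ext x; simp [abs_lt]
    have hpdf : ∀ x ∈ Set.Ioo (-t) t,
        (√(2 * Real.pi * v))⁻¹ * Real.exp (-2) ≤ gaussianPDFReal 0 v x := by
      intro x hx
      rw [gaussianPDFReal_def]
      dsimp only
      gcongr
      rw [sub_zero, neg_div, neg_le_neg_iff, div_le_iff₀ (by positivity)]
      have h1 : x ^ 2 ≤ t ^ 2 := sq_le_sq' hx.1.le hx.2.le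
      have h2 : t ^ 2 = 100 * v * L ^ 2 := by rw [ht, mul_pow, mul_pow, hsq]; ring
      have h3 : L ^ 2 ≤ 1 / 25 := by nlinarith
      nlinarith
    have hint := setIntegral_mono_on (μ := volume) (s := Set.Ioo (-t) t)
      (integrableOn_const (C := (√(2 * Real.pi * v))⁻¹ * Real.exp (-2)) (by simp))
      (integrable_gaussianPDFReal 0 v).integrableOn measurableSet_Ioo hpdf
    rw [hset, measureReal_def, gaussianReal_apply_eq_integral _ hv, ENNReal.toReal_ofReal
      (setIntegral_nonneg measurableSet_Ioo fun x _ => gaussianPDFReal_nonneg 0 v x)]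
    refine lt_of_lt_of_le ?_ hint
    have hvol : volume.real (Set.Ioo (-t) t) = 2 * t := by
      rw [Real.volume_real_Ioo_of_le (by linarith)]; ring
    rw [setIntegral_const, hvol, smul_eq_mul]
    have hexp : 1 - Real.exp (-L) < L := by
      have := Real.add_one_lt_exp (neg_ne_zero.2 hL.ne')
      linarith
    refine hexp.trans_le ?_
    have hpi : √(2 * Real.pi) ≤ 2.51 := by
      rw [Real.sqrt_le_left (by norm_num)]
      have := Real.pi_lt_d2
      norm_num at this ⊢
      linarith
    have he : Real.exp 2 ≤ 7.4 := by
      have h1 := Real.exp_one_lt_d9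
      have : Real.exp 2 = Real.exp 1 ^ 2 := by rw [← Real.exp_nat_mul]; norm_num
      rw [this]
      calc Real.exp 1 ^ 2 ≤ 2.72 ^ 2 := by gcongr; linarith
        _ ≤ 7.4 := by norm_num
    have hprod : √(2 * Real.pi) * Real.exp 2 ≤ 20 := by
      calc √(2 * Real.pi) * Real.exp 2 ≤ 2.51 * 7.4 := by gcongr
        _ ≤ 20 := by norm_num
    rw [Real.exp_neg, Real.sqrt_mul (by positivity), ← mul_inv, ← div_eq_mul_inv,
      le_div_iff₀ (by positivity), ht]
    calc L * (√(2 * Real.pi) * √(v : ℝ) * Real.exp 2)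
        = (√(2 * Real.pi) * Real.exp 2) * (√(v : ℝ) * L) := by ring
      _ ≤ 20 * (√(v : ℝ) * L) := by gcongr
      _ = _ := by ring
  -- For `L > 1/5` the two tails total at most `2 exp (-50 L²)`, which is below `exp (-L)` because
  -- `2 < e` and `1 + L ≤ 50 L²`.
  · have hsub : HasSubgaussianMGF (fun x : ℝ => x) v (gaussianReal 0 v) :=
      ⟨fun s => integrable_exp_mul_gaussianReal s, fun s => by
        rw [mgf_fun_id_gaussianReal]; simp⟩
    have h1 := hsub.measure_ge_le ht0.le
    have h2 := hsub.neg.measure_ge_le ht0.le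
    have hE : -t ^ 2 / (2 * v) = -(50 * L ^ 2) := by
      rw [ht, mul_pow, mul_pow, hsq]; field_simp; norm_num
    rw [hE] at h1 h2
    have hcompl : (gaussianReal 0 v).real {x | |x| < t}ᶜ ≤ 2 * Real.exp (-(50 * L ^ 2)) := by
      calc _ ≤ (gaussianReal 0 v).real ({x | t ≤ x} ∪ {x | t ≤ (-fun x : ℝ => x) x}) :=
            measureReal_mono fun x (hx : ¬ |x| < t) => le_abs.1 (not_lt.1 hx)
        _ ≤ _ := measureReal_union_le _ _
        _ ≤ _ := by rw [two_mul]; exact add_le_add h1 h2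
    have hms : MeasurableSet {x : ℝ | |x| < t} :=
      measurableSet_lt (by fun_prop) measurable_const
    rw [probReal_compl_eq_one_sub hms] at hcompl
    have hlt : 2 * Real.exp (-(50 * L ^ 2)) < Real.exp (-L) := by
      have h3 : (2 : ℝ) < Real.exp 1 := by have := Real.exp_one_gt_d9; linarith
      calc 2 * Real.exp (-(50 * L ^ 2)) < Real.exp 1 * Real.exp (-(50 * L ^ 2)) := by gcongr
        _ = Real.exp (1 - 50 * L ^ 2) := by rw [← Real.exp_add]; ring_nf
        _ ≤ _ := Real.exp_le_exp.2 (by nlinarith)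
    linarith

/-! ### Consequences of convergence in distribution. -/

section Distribution

variable {Ω Ω' : Type*} {mΩ : MeasurableSpace Ω} {mΩ' : MeasurableSpace Ω'} {P : Measure Ω}
  {P' : Measure Ω'} [IsProbabilityMeasure P] [IsProbabilityMeasure P']
  {X Y : ℕ → Ω → ℝ} {Z : Ω' → ℝ}

/-- The portmanteau inequality for open sets; strictness in the limit yields the bound at every
large finite index. -/
lemma MeasureTheory.TendstoInDistribution.eventually_lt_measure_open
    (h : TendstoInDistribution X atTop Z (fun _ => P) P') {U : Set ℝ} (hU : IsOpen U) {a : ℝ}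
    (ha : a < (P'.map Z).real U) : ∀ᶠ n in atTop, a < P.real (X n ⁻¹' U) := by
  have : IsProbabilityMeasure (P'.map Z) := Measure.isProbabilityMeasure_map h.aemeasurable_limit
  rcases lt_or_ge a 0 with ha0 | ha0
  · exact Eventually.of_forall fun n => ha0.trans_le measureReal_nonneg
  have hlim := ProbabilityMeasure.le_liminf_measure_open_of_tendsto h.tendsto hU
  have hlt : ENNReal.ofReal a < (P'.map Z) U := by
    rw [ENNReal.ofReal_lt_iff_lt_toReal ha0 (measure_ne_top _ _)]; exact ha
  filter_upwards [eventually_lt_of_lt_liminf (hlt.trans_le hlim)] with n hn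
  simp only [ProbabilityMeasure.coe_mk] at hn
  rw [Measure.map_apply_of_aemeasurable (h.forall_aemeasurable n) hU.measurableSet,
    ENNReal.ofReal_lt_iff_lt_toReal ha0 (measure_ne_top _ _)] at hn
  exact hn

lemma MeasureTheory.TendstoInDistribution.tendstoInMeasure_zero
    (h : TendstoInDistribution X atTop (fun _ => (0 : ℝ)) (fun _ => P) P') :
    TendstoInMeasure P X atTop fun _ => 0 := by
  rw [tendstoInMeasure_iff_measureReal_norm]
  intro κ hκ
  have hU : IsOpen {x : ℝ | |x| < κ} := isOpen_lt (by fun_prop) (by fun_prop)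
  rw [Metric.tendsto_nhds]
  intro ρ hρ
  have hone : (P'.map fun _ => (0 : ℝ)).real {x : ℝ | |x| < κ} = 1 := by
    rw [Measure.map_const, measure_univ, one_smul, measureReal_def,
      Measure.dirac_apply' _ hU.measurableSet]
    simp [hκ]
  filter_upwards [h.eventually_lt_measure_open hU (a := 1 - ρ) (by rw [hone]; linarith)] with n hn
  have hcompl : {ω | κ ≤ ‖X n ω - 0‖} = (X n ⁻¹' {x : ℝ | |x| < κ})ᶜ := by
    ext ω; simp
  have hnull : NullMeasurableSet (X n ⁻¹' {x : ℝ | |x| < κ}) P :=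
    (h.forall_aemeasurable n).nullMeasurableSet_preimage hU.measurableSet
  rw [hcompl, probReal_compl_eq_one_sub₀ hnull, Real.dist_0_eq_abs, abs_of_nonneg
    (sub_nonneg.2 measureReal_le_one)]
  linarith

/-- A sequence that converges in distribution, times one that vanishes almost surely in the limit,
vanishes in probability. -/
lemma MeasureTheory.TendstoInDistribution.mul_tendstoInMeasure_zero
    (h : TendstoInDistribution X atTop Z (fun _ => P) P') (hY : ∀ n, Measurable (Y n))
    (hY0 : ∀ᵐ ω ∂P, Tendsto (fun n => Y n ω) atTop (𝓝 0)) :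
    TendstoInMeasure P (fun n ω => X n ω * Y n ω) atTop fun _ => 0 := by
  have hYm : TendstoInMeasure P Y atTop fun _ => (0 : ℝ) :=
    tendstoInMeasure_of_tendsto_ae (fun n => (hY n).aestronglyMeasurable) hY0
  have := h.continuous_comp_prodMk_of_tendstoInMeasure_const (g := fun p : ℝ × ℝ => p.1 * p.2)
    (by fun_prop) hYm fun n => (hY n).aemeasurable
  simp only [mul_zero] at this
  exact this.tendstoInMeasure_zero

end Distribution

/-! ### Asymptotic normality and the convergence rate. -/

namespace LendingPool

lemma measurable_noise (s : ℕ) : Measurable (noise s) :=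
  (measurable_fst.comp measurable_snd).comp (measurable_pi_apply s)

lemma measurable_empMean {f : ℕ → (ℕ → Slot) → ℝ} (hf : ∀ s, Measurable (f s)) (n : ℕ) :
    Measurable fun ω => empMean (fun s => f s ω) n :=
  (Finset.measurable_fun_sum _ fun s _ => hf s).div_const _

/-- Normalized slope of the least-squares fit. -/
def fittedSlope (m : Market) (r₀ : ℝ) (n : ℕ) (ω : ℕ → Slot) : ℝ :=
  -m.η * (empMean (fun s => rateError m r₀ s ω ^ 2) n - empMean (fun s => rateError m r₀ s ω) n ^ 2)
    + (empMean (fun s => rateError m r₀ s ω * noise s ω) n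
      - empMean (fun s => rateError m r₀ s ω) n * empMean (fun s => noise s ω) n)

/-- Limit of the normalized slope of the least-squares fit, negated. -/
def limitSlope (m : Market) (K : Controller) : ℝ :=
  m.η * (exploreMeanSq m K - exploreMean m K ^ 2)

lemma limitSlope_pos (m : Market) (hη : 0 < m.η) (K : Controller) : 0 < limitSlope m K :=
  mul_pos hη (sub_pos.2 (exploreMean_sq_lt_exploreMeanSq m K))

/-- Asymptotic variance of the leading term of the estimation error, in units of the noise. -/
def limitEnergy (m : Market) (K : Controller) : ℝ≥0 :=
  Real.toNNReal (exploreMeanSq m K * (exploreMeanSq m K - exploreMean m K ^ 2))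

lemma limitEnergy_pos (m : Market) (K : Controller) : 0 < limitEnergy m K :=
  Real.toNNReal_pos.2 (mul_pos (exploreMeanSq_pos m K)
    (sub_pos.2 (exploreMean_sq_lt_exploreMeanSq m K)))

lemma coe_limitEnergy (m : Market) (K : Controller) :
    (limitEnergy m K : ℝ) = exploreMeanSq m K * (exploreMeanSq m K - exploreMean m K ^ 2) :=
  Real.coe_toNNReal _ (mul_pos (exploreMeanSq_pos m K)
    (sub_pos.2 (exploreMean_sq_lt_exploreMeanSq m K))).le

section Limits

variable {m : Market} {K : Controller} {r₀ : ℝ} {ω : ℕ → Slot} {v R : ℝ}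

lemma tendsto_fittedSlope (h : AdaptiveRegression m.η (exploreProb m K) (exploreMean m K)
      (exploreMeanSq m K) v R (fun s => rateError m r₀ s ω) (fun s => noise s ω) (explored ω)
      (fun n => estimateError m r₀ n ω)) :
    Tendsto (fun n => fittedSlope m r₀ n ω) atTop (𝓝 (-limitSlope m K)) := by
  obtain ⟨B, hB⟩ := h.exists_abs_le
  have hz : Tendsto (empMean fun s => rateError m r₀ s ω * noise s ω) atTop (𝓝 0) := by
    refine h.tendsto_transform (K := B ^ 2) fun n => ?_
    rcases Nat.eq_zero_or_pos n with rfl | hn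
    · simp [empMean]; positivity
    · rw [← empMean_const (B ^ 2) hn]
      exact empMean_mono fun s => sq_le_sq.2 ((hB s).trans (le_abs_self B))
  have := (((h.tendsto_mean_sq.sub (h.tendsto_mean.pow 2)).const_mul (-m.η)).add
    (hz.sub (h.tendsto_mean.mul h.tendsto_noise)))
  have hlim : -limitSlope m K = -m.η * (exploreMeanSq m K - exploreMean m K ^ 2)
      + (0 - exploreMean m K * 0) := by rw [limitSlope]; ring
  rw [hlim]
  exact this

lemma eventually_estimateError_eq (h : AdaptiveRegression m.η (exploreProb m K) (exploreMean m K)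
      (exploreMeanSq m K) v R (fun s => rateError m r₀ s ω) (fun s => noise s ω) (explored ω)
      (fun n => estimateError m r₀ n ω)) :
    ∀ᶠ n in atTop, estimateError m r₀ n ω = (empMean (fun s => rateError m r₀ s ω) n
      * empMean (fun s => rateError m r₀ s ω * noise s ω) n
        - empMean (fun s => rateError m r₀ s ω ^ 2) n * empMean (fun s => noise s ω) n)
      / fittedSlope m r₀ n ω := by
  have hvar := h.tendsto_mean_sq.sub (h.tendsto_mean.pow 2)
  filter_upwards [eventually_ge_atTop 1,
    hvar.eventually_ne (sub_pos.2 (exploreMean_sq_lt_exploreMeanSq m K)).ne',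
    (tendsto_fittedSlope h).eventually_ne (neg_ne_zero.2 (limitSlope_pos m h.η_pos K).ne')]
    with n hn h1 h2
  exact h.estimate_eq n hn h1 h2

end Limits

/-- Asymptotic normality of the least-squares estimate. -/
theorem tendstoInDistribution_estimateError (m : Market) (hη : 0 < m.η) (K : Controller) (r₀ : ℝ) :
    TendstoInDistribution (fun (n : ℕ) ω => √n * estimateError m r₀ n ω) atTop
      (fun x => -(limitSlope m K)⁻¹ * x) (fun _ => poolLaw m K)
      (gaussianReal 0 (m.ζ ^ 2 * limitEnergy m K)) := by
  have hnoise := isGaussianNoise m K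
  have htyp := ae_adaptiveRegression m hη K r₀
  have hκ := limitSlope_pos m hη K
  have hxm : ∀ s, Measurable (rateError m r₀ s) := fun s =>
    (measurable_rateError m r₀ s).mono (slotFiltration.le s) le_rfl
  have hA : ∀ n, Measurable fun ω => empMean (fun s => rateError m r₀ s ω) n :=
    measurable_empMean hxm
  have hQ : ∀ n, Measurable fun ω => empMean (fun s => rateError m r₀ s ω ^ 2) n :=
    measurable_empMean fun s => (hxm s).pow_const 2
  have hZ : ∀ n, Measurable fun ω => empMean (fun s => rateError m r₀ s ω * noise s ω) n :=
    measurable_empMean fun s => (hxm s).mul (measurable_noise s)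
  have hE : ∀ n, Measurable fun ω => empMean (fun s => noise s ω) n :=
    measurable_empMean measurable_noise
  have hden : ∀ n, Measurable (fittedSlope m r₀ n) := fun n =>
    (((hQ n).sub ((hA n).pow_const 2)).const_mul _).add ((hZ n).sub ((hA n).mul (hE n)))
  -- With `A` and `Q` replaced by their limits, the numerator `A Z - Q E` is the mean of `(a x_s -
  -- q) ε_s`; its mean energy tends to `a² q - 2 a² q + q² = q (q - a²)`.
  have hmain := hnoise.tendstoInDistribution_sum (q := limitEnergy m K)
    (h := fun s ω => exploreMean m K * rateError m r₀ s ω - exploreMeanSq m K)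
    (fun s => ((measurable_rateError m r₀ s).const_mul _).sub_const _) (by
      filter_upwards [htyp] with ω h
      have h1 := ((h.tendsto_mean_sq.const_mul (exploreMean m K ^ 2)).sub
        (h.tendsto_mean.const_mul (2 * exploreMean m K * exploreMeanSq m K))).add_const
        (exploreMeanSq m K ^ 2)
      have hlim : exploreMean m K ^ 2 * exploreMeanSq m K
          - 2 * exploreMean m K * exploreMeanSq m K * exploreMean m K + exploreMeanSq m K ^ 2
          = (limitEnergy m K : ℝ) := by
        rw [coe_limitEnergy]; ring
      rw [hlim] at h1
      refine h1.congr' ?_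
      filter_upwards [eventually_gt_atTop 0] with n hn
      rw [← empMean_const (exploreMeanSq m K ^ 2) hn, ← empMean_const_mul, ← empMean_const_mul,
        ← empMean_sub, ← empMean_add]
      unfold empMean
      congr 2; ext s; ring)
  have hsumZ := hnoise.tendstoInDistribution_sum
    (q := Real.toNNReal (exploreMeanSq m K))
    (h := rateError m r₀) (measurable_rateError m r₀) (by
      filter_upwards [htyp] with ω h
      rw [Real.coe_toNNReal _ (exploreMeanSq_pos m K).le]
      exact h.tendsto_mean_sq)
  have hsumE := hnoise.tendstoInDistribution_sum (q := 1) (h := fun _ _ => (1 : ℝ))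
    (fun s => measurable_const) (ae_of_all _ fun ω => by
      refine tendsto_const_nhds.congr' ?_
      filter_upwards [eventually_gt_atTop 0] with n hn
      have : (n : ℝ) ≠ 0 := by positivity
      simp [this])
  have hmain' := hmain.continuous_comp (g := fun x : ℝ => -(limitSlope m K)⁻¹ * x) (by fun_prop)
  have hcancel : ∀ b : ℝ, b / -limitSlope m K + b * (limitSlope m K)⁻¹ = 0 := fun b => by
    rw [div_neg, div_eq_mul_inv, neg_add_cancel]
  -- Replacing the random coefficients of `√n Z` and `√n E` by their limits costs a vanishing factor
  -- times a sequence that converges in distribution.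
  have hremZ := hsumZ.mul_tendstoInMeasure_zero
    (Y := fun n ω => empMean (fun s => rateError m r₀ s ω) n / fittedSlope m r₀ n ω
      + exploreMean m K * (limitSlope m K)⁻¹)
    (fun n => ((hA n).div (hden n)).add_const _) (by
      filter_upwards [htyp] with ω h
      have := (h.tendsto_mean.div (tendsto_fittedSlope h) (neg_ne_zero.2 hκ.ne')).add_const
        (exploreMean m K * (limitSlope m K)⁻¹)
      rw [hcancel] at this
      exact this)
  have hremE := hsumE.mul_tendstoInMeasure_zero
    (Y := fun n ω => -(empMean (fun s => rateError m r₀ s ω ^ 2) n / fittedSlope m r₀ n ω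
      + exploreMeanSq m K * (limitSlope m K)⁻¹))
    (fun n => (((hQ n).div (hden n)).add_const _).neg) (by
      filter_upwards [htyp] with ω h
      have := ((h.tendsto_mean_sq.div (tendsto_fittedSlope h) (neg_ne_zero.2 hκ.ne')).add_const
        (exploreMeanSq m K * (limitSlope m K)⁻¹)).neg
      rw [hcancel, neg_zero] at this
      exact this)
  have hest : ∀ n : ℕ, Measurable fun ω => √n * estimateError m r₀ n ω := fun n =>
    (measurable_estimateError m r₀ n).const_mul _
  have hmm : ∀ n : ℕ, Measurable fun ω => -(limitSlope m K)⁻¹ * ((∑ s ∈ Finset.range n,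
      (exploreMean m K * rateError m r₀ s ω - exploreMeanSq m K) * noise s ω) / √n) := fun n =>
    ((Finset.measurable_fun_sum _ fun s _ => (((hxm s).const_mul _).sub_const _).mul
      (measurable_noise s)).div_const _).const_mul _
  set W₁ : ℕ → (ℕ → Slot) → ℝ := fun n ω =>
    (∑ s ∈ Finset.range n, rateError m r₀ s ω * noise s ω) / √n
      * (empMean (fun s => rateError m r₀ s ω) n / fittedSlope m r₀ n ω
      + exploreMean m K * (limitSlope m K)⁻¹) with hW₁
  set W₂ : ℕ → (ℕ → Slot) → ℝ := fun n ω => (∑ s ∈ Finset.range n, 1 * noise s ω) / √n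
      * -(empMean (fun s => rateError m r₀ s ω ^ 2) n / fittedSlope m r₀ n ω
      + exploreMeanSq m K * (limitSlope m K)⁻¹) with hW₂
  have hW₁m : ∀ n, Measurable (W₁ n) := fun n =>
    ((Finset.measurable_fun_sum _ fun s _ => (hxm s).mul (measurable_noise s)).div_const _).mul
      (((hA n).div (hden n)).add_const _)
  have hW₂m : ∀ n, Measurable (W₂ n) := fun n =>
    ((Finset.measurable_fun_sum _ fun s _ => (measurable_noise s).const_mul 1).div_const _).mul
      (((hQ n).div (hden n)).add_const _).neg
  have hrestm : ∀ n : ℕ, Measurable fun ω => √n * estimateError m r₀ n ω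
      - -(limitSlope m K)⁻¹ * ((∑ s ∈ Finset.range n,
      (exploreMean m K * rateError m r₀ s ω - exploreMeanSq m K) * noise s ω) / √n)
      - W₁ n ω - W₂ n ω := fun n => (((hest n).sub (hmm n)).sub (hW₁m n)).sub (hW₂m n)
  -- The decomposition is an exact identity once the closed formula for the estimate is valid, so on
  -- almost every path this remainder is eventually zero.
  have hrest : TendstoInMeasure (poolLaw m K) (fun (n : ℕ) ω => √n * estimateError m r₀ n ω
      - -(limitSlope m K)⁻¹ * ((∑ s ∈ Finset.range n,
      (exploreMean m K * rateError m r₀ s ω - exploreMeanSq m K) * noise s ω) / √n)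
      - W₁ n ω - W₂ n ω) atTop fun _ => 0 := by
    refine tendstoInMeasure_of_tendsto_ae (fun n => (hrestm n).aestronglyMeasurable) ?_
    filter_upwards [htyp] with ω h
    refine tendsto_const_nhds.congr' ?_
    filter_upwards [eventually_estimateError_eq h, eventually_gt_atTop 0] with n hn hn0
    have hn' : (0 : ℝ) < n := by exact_mod_cast hn0
    have hs : ∀ f : ℕ → ℝ, √n * empMean f n = (∑ s ∈ Finset.range n, f s) / √n := by
      intro f
      have h2 : √(n : ℝ) ≠ 0 := (Real.sqrt_pos.2 hn').ne'
      have h3 : (n : ℝ) = √n * √n := (Real.mul_self_sqrt hn'.le).symm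
      rw [empMean]
      nth_rewrite 2 [h3]
      field_simp
    have h1 := hs fun s => rateError m r₀ s ω * noise s ω
    have h2 := hs fun s => noise s ω
    have hsplit : (∑ s ∈ Finset.range n,
        (exploreMean m K * rateError m r₀ s ω - exploreMeanSq m K) * noise s ω) / √n
        = exploreMean m K * (√n * empMean (fun s => rateError m r₀ s ω * noise s ω) n)
          - exploreMeanSq m K * (√n * empMean (fun s => noise s ω) n) := by
      rw [h1, h2, ← mul_div_assoc, ← mul_div_assoc, ← sub_div, Finset.mul_sum, Finset.mul_sum,
        ← Finset.sum_sub_distrib]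
      congr 1
      exact Finset.sum_congr rfl fun s _ => by ring
    simp only [hW₁, hW₂, one_mul]
    rw [hsplit, hn, ← h1, ← h2]
    ring
  -- Slutsky's theorem, once for each remainder.
  have hfinal := ((hmain'.add_of_tendstoInMeasure_const hremZ fun n =>
    (hW₁m n).aemeasurable).add_of_tendstoInMeasure_const hremE fun n =>
    (hW₂m n).aemeasurable).add_of_tendstoInMeasure_const hrest fun n => (hrestm n).aemeasurable
  refine hfinal.congr (fun n => ae_of_all _ fun ω => ?_) (ae_of_all _ fun x => ?_)
  · simp only [Pi.add_apply, Function.comp]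
    ring
  · simp

/-- The least-squares controller converges at rate `log (1 / δ) / √τ`. -/
theorem lsEstimator_isConvergenceBound (m : Market) (hη : 0 < m.η) (K : Controller) :
    ∃ C : ℝ, 0 < C ∧ ∀ r₀ p₀ B₀ : ℝ, 0 < p₀ → 0 < B₀ →
      IsConvergenceBound m K lsEstimator r₀ p₀ B₀
        (fun δ τ => C * (Real.log (1 / δ) / Real.sqrt τ)) := by
  have hκ := limitSlope_pos m hη K
  have hv : m.ζ ^ 2 * limitEnergy m K ≠ 0 :=
    mul_ne_zero (pow_pos m.ζ_pos 2).ne' (limitEnergy_pos m K).ne'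
  set v := m.ζ ^ 2 * limitEnergy m K with hvdef
  have hsv : 0 < √(v : ℝ) := Real.sqrt_pos.2 (by positivity)
  -- The first factor is the scale of the linear map in the limit law, the second comes from the
  -- Gaussian comparison; neither involves the initial data or `δ`.
  refine ⟨(limitSlope m K)⁻¹ * (10 * √v), by positivity, fun r₀ p₀ B₀ hp hB δ hδ hδ1 => ?_⟩
  have hL : 0 < Real.log (1 / δ) := Real.log_pos (by rw [lt_div_iff₀ hδ]; linarith)
  have hexp : Real.exp (-Real.log (1 / δ)) = δ := by
    rw [one_div, Real.log_inv, neg_neg, Real.exp_log hδ]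
  set L := Real.log (1 / δ)
  set U : Set ℝ := {x | |x| < (limitSlope m K)⁻¹ * (10 * √v) * L} with hU
  have hUo : IsOpen U := isOpen_lt (by fun_prop) (by fun_prop)
  have hmass : 1 - δ < ((gaussianReal 0 v).map fun x => -(limitSlope m K)⁻¹ * x).real U := by
    rw [map_measureReal_apply (by fun_prop) hUo.measurableSet]
    have hset : (fun x : ℝ => -(limitSlope m K)⁻¹ * x) ⁻¹' U = {x | |x| < 10 * √v * L} := by
      ext x
      simp only [hU, Set.mem_preimage, Set.mem_ofPred_eq]
      rw [abs_mul, abs_neg, abs_of_pos (inv_pos.2 hκ), mul_assoc]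
      exact mul_lt_mul_iff_right₀ (inv_pos.2 hκ)
    rw [hset, ← hexp]
    exact one_sub_exp_lt_gaussianReal v hv hL
  obtain ⟨T, hT⟩ := eventually_atTop.1
    ((tendstoInDistribution_estimateError m hη K r₀).eventually_lt_measure_open hUo hmass)
  -- The event for the actual pool and the event for the rescaled sample error coincide up to a null
  -- set.
  refine ⟨T, fun τ hτ => (hT τ hτ.le).le.trans_eq (measureReal_congr ?_)⟩
  filter_upwards [stoppedRate_ae_eq K lsEstimator_isLocal measurable_lsEstimator r₀ hp hB] with ω hω
  have hτ1 : 1 ≤ τ := by omega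
  have hs : 0 < √(τ : ℝ) := Real.sqrt_pos.2 (by exact_mod_cast hτ1)
  refine propext ?_
  change |√(τ : ℝ) * estimateError m r₀ τ ω| < _ ↔ |stoppedRate m lsEstimator r₀ p₀ B₀ τ ω
    - m.equilibriumRate| < (limitSlope m K)⁻¹ * (10 * √v) * (L / √τ)
  rw [hω τ hτ1, abs_mul, abs_of_pos hs, ← mul_div_assoc, lt_div_iff₀ hs, mul_comm]
  rfl

end LendingPool

end

theorem mainTheorem2 (m : LendingPool.Market) (hη : 0 < m.η) (K : LendingPool.Controller) :
    (∃ C : ℝ, 0 < C ∧ ∀ r₀ p₀ B₀ : ℝ, 0 < p₀ → 0 < B₀ →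
      LendingPool.IsConvergenceBound m K LendingPool.lsEstimator r₀ p₀ B₀
        (fun δ τ => C * (Real.log (1 / δ) / Real.sqrt τ))) ∧
    (∀ r₀ p₀ B₀ : ℝ, 0 < p₀ → 0 < B₀ → ∀ τ : ℕ, 1 ≤ τ →
      MeasureTheory.Integrable
        (LendingPool.stoppedRate m (LendingPool.knownElasticityEstimator m.η) r₀ p₀ B₀ τ)
        (LendingPool.poolLaw m K) ∧
      ∫ ω, LendingPool.stoppedRate m (LendingPool.knownElasticityEstimator m.η) r₀ p₀ B₀ τ ω
        ∂(LendingPool.poolLaw m K) = m.equilibriumRate) := by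
  exact ⟨LendingPool.lsEstimator_isConvergenceBound m hη K, fun r₀ _ _ hp hB _ hτ =>
    LendingPool.knownElasticity_unbiased m hη K r₀ hp hB hτ⟩
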